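/- **Theorem 1.** Let $m\ge 1$ and $\tau\ge 1$ be integers, $0<\alpha<1$, $L>0$, $\sigma,\kappa\in\mathbb{R}$. Let $\mathcal D_1,\dots,\mathcal D_m$ be probability distributions of data, $\ell(\cdot\,;\cdot)$ a loss with $\ell(x;\cdot)$ integrable under every $\mathcal D_i$, $F_i(x)=\mathbb E_{s\sim\mathcal D_i}[\ell(x;s)]$ and $F(x)=\frac1m\sum_{i=1}^m F_i(x)$ for $x\in\mathbb R^d$, and let $F_{\inf}\in\mathbb R$ satisfy $F_{\inf}\le F(x)$ for all $x$. Let $g_i(x;\xi)\in\mathbb R^d$ be stochastic gradients. Assume, for all $i$, $x$, $y$: 1. $F_i$ is differentiable and $\|\nabla F_i(x)-\nabla F_i(y)\|\le L\|x-y\|$; 2. $\mathbb E_{\xi\sim\mathcal D_i}[g_i(x;\xi)]=\nabla F_i(x)$; 3. $\mathbb E_{\xi\sim\mathcal D_i}\big[\|g_i(x;\xi)-\nabla F_i(x)\|^2\big]\le\sigma^2$; 4. $\frac1m\sum_{i=1}^m\|\nabla F_i(x)-\nabla F(x)\|^2\le\kappa^2$. Let $\xi_k^{(i)}\sim\mathcal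 D_i$ ($k\ge 0$, $1\le i\le m$) be independent samples. Overlap-Local-SGD with learning rate $\eta$ starts all local models and the anchor at one point, $x_0^{(1)}=\dots=x_0^{(m)}=z_0$, and iterates, for $k\ge 0$, $$x^{(i)}_{k+\frac12}=x^{(i)}_k-\eta\, g_i(x^{(i)}_k;\xi^{(i)}_k),$$ $$x^{(i)}_{k+1}=\begin{cases}x^{(i)}_{k+\frac12}-\alpha\,(x^{(i)}_{k+\frac12}-z_k)&\text{if }\tau\mid k+1,\\ x^{(i)}_{k+\frac12}&\text{otherwise,}\end{cases}\qquad z_{k+1}=\begin{cases}\frac1m\sum_{i=1}^m x^{(i)}_{k+1}&\text{if }\tau\mid k+1,\\ z_k&\text{otherwise.}\end{cases}$$ Put $y_k=(1-\alpha)\frac1m\sum_{i=1}^m x^{(i)}_k+\alpha z_k$. Let $K$ be an integer with $K\ge 60m\tau^2/\alpha^2$, and let $\eta=\frac1L\sqrt{m/K}$. Then $$y_{k+1}=y_k-(1-\alpha)\eta\,\frac1m\sum_{i=1}^m g_i(x^{(i)}_k;\xi^{(i)}_k)\qquad(k\ge 0),$$ all the expectations $\mathbb E\|\nabla F(y_k)\|^2$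 are finite, and $$\frac1K\sum_{k=0}^{K-1}\mathbb E\big[\|\nabla F(y_k)\|^2\big]\le\frac{4L\,[F(y_0)-F_{\inf}]}{(1-\alpha)\sqrt{mK}}+\frac{2(1-\alpha)\sigma^2}{\sqrt{mK}}+\frac{2m\sigma^2}{K}\Big[\frac{2\tau}{(2-\alpha)\alpha}-1\Big]+\frac{2m\tau^2\kappa^2}{\alpha^2K}.$$ For fixed $L$, $F(y_0)-F_{\inf}$, $\sigma$, $\kappa$, $\alpha$, $\tau$, the right-hand side is at most $C_1/\sqrt{mK}+C_2\,m/K$ for all $m,K\ge1$, with $C_1,C_2$ independent of $m$ and $K$; in particular, for fixed $m$, it is $O(1/\sqrt{mK})+O(1/K)$. -/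

import Mathlib

open MeasureTheory ProbabilityTheory

namespace OverlapLocalSGD

noncomputable section

/-- The local objective `F_i(x) = E_{s ∼ D_i}[ℓ(x; s)]`. -/
def localObjective {d m : ℕ} {S : Type*} [MeasurableSpace S]
    (ℓ : EuclideanSpace ℝ (Fin d) → S → ℝ) (D : Fin m → Measure S) (i : Fin m)
    (x : EuclideanSpace ℝ (Fin d)) : ℝ :=
  ∫ s, ℓ x s ∂(D i)

/-- The global objective `F(x) = (1/m) ∑ i, F_i(x)`. -/
def objective {d m : ℕ} {S : Type*} [MeasurableSpace S]
    (ℓ : EuclideanSpace ℝ (Fin d) → S → ℝ) (D : Fin m → Measure S)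
    (x : EuclideanSpace ℝ (Fin d)) : ℝ :=
  (1 / (m : ℝ)) * ∑ i, localObjective ℓ D i x

/-- The models held at a given iteration: the local models `x^(1), …, x^(m)` and the anchor `z`. -/
structure State (d m : ℕ) where
  x : Fin m → EuclideanSpace ℝ (Fin d)
  z : EuclideanSpace ℝ (Fin d)

/-- All local models and the anchor start at the same point. -/
def initialState {d : ℕ} (m : ℕ) (x₀ : EuclideanSpace ℝ (Fin d)) : State d m where
  x := fun _ => x₀
  z := x₀

/-- The stochastic gradient step `x^(i)_{k+1/2} = x^(i)_k - η g_i(x^(i)_k; ξ^(i)_k)`. -/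
def halfStep {d m : ℕ} {S : Type*}
    (g : Fin m → EuclideanSpace ℝ (Fin d) → S → EuclideanSpace ℝ (Fin d)) (η : ℝ)
    (ξ : Fin m → S) (s : State d m) (i : Fin m) : EuclideanSpace ℝ (Fin d) :=
  s.x i - η • g i (s.x i) (ξ i)

/-- The new local models: pulled back towards the old anchor iff `τ` divides `k + 1`. -/
def nextLocal {d m : ℕ} {S : Type*}
    (g : Fin m → EuclideanSpace ℝ (Fin d) → S → EuclideanSpace ℝ (Fin d)) (η α : ℝ) (τ k : ℕ)
    (ξ : Fin m → S) (s : State d m) (i : Fin m) : EuclideanSpace ℝ (Fin d) :=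
  if (k + 1) % τ = 0 then
    halfStep g η ξ s i - α • (halfStep g η ξ s i - s.z)
  else
    halfStep g η ξ s i

/-- Iteration `k` of Overlap-Local-SGD; the anchor becomes the average of the new local models
iff `τ` divides `k + 1`. -/
def step {d m : ℕ} {S : Type*}
    (g : Fin m → EuclideanSpace ℝ (Fin d) → S → EuclideanSpace ℝ (Fin d)) (η α : ℝ) (τ k : ℕ)
    (ξ : Fin m → S) (s : State d m) : State d m where
  x := nextLocal g η α τ k ξ s
  z := if (k + 1) % τ = 0 then (1 / (m : ℝ)) • ∑ i, nextLocal g η α τ k ξ s i else s.z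

/-- The state after `k` iterations, when iteration `j` uses the samples `ξ j`. -/
def iterate {d m : ℕ} {S : Type*}
    (g : Fin m → EuclideanSpace ℝ (Fin d) → S → EuclideanSpace ℝ (Fin d)) (η α : ℝ) (τ : ℕ)
    (x₀ : EuclideanSpace ℝ (Fin d)) (ξ : ℕ → Fin m → S) : ℕ → State d m
  | 0 => initialState m x₀
  | k + 1 => step g η α τ k (ξ k) (iterate g η α τ x₀ ξ k)

/-- The virtual averaged model `y = (1 - α) (1/m) ∑ i, x^(i) + α z`. -/
def virtualModel {d m : ℕ} (α : ℝ) (s : State d m) : EuclideanSpace ℝ (Fin d) :=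
  (1 - α) • ((1 / (m : ℝ)) • ∑ i, s.x i) + α • s.z

/-- The learning rate `η = (1/L) √(m/K)`. -/
def learningRate (L : ℝ) (m K : ℕ) : ℝ :=
  (1 / L) * Real.sqrt ((m : ℝ) / (K : ℝ))

/-- The explicit four-term bound, where `Δ` stands for `F(y_0) - F_inf`. -/
def errorBound (L Δ σ κ α : ℝ) (τ m K : ℕ) : ℝ :=
  4 * L * Δ / ((1 - α) * Real.sqrt ((m : ℝ) * (K : ℝ)))
    + 2 * (1 - α) * σ ^ 2 / Real.sqrt ((m : ℝ) * (K : ℝ))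
    + 2 * (m : ℝ) * σ ^ 2 / (K : ℝ) * (2 / ((2 - α) * α) * (τ : ℝ) - 1)
    + 2 * (m : ℝ) * (τ : ℝ) ^ 2 * κ ^ 2 / (α ^ 2 * (K : ℝ))

end

end OverlapLocalSGD

/-!
The virtual model `y` never sees the pullback: it performs plain gradient descent with step
`(1 - α) η` along the average of the stochastic gradients. Compared with descent on `F` itself, the
only errors are the gradient noise and the distances of the local models from `y`. Such a distance
splits into the deviation of a local model from the average model and the gap between the average
and `y`. Up to the factors `η` and `α`, these two are sums of the past search directions, multiplied
by `1 - α` respectively by `0` every `τ` iterations. The weights of such a sum add up to at most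
`τ / α`, so by Young's convolution inequality the drift that the deviations cause in the local
gradients feeds back with a factor of order `(η L τ / α) ^ 2`, which the choice of `η` makes small
enough to be absorbed.

A sample is independent of everything computed before it is drawn, hence the noises of different
iterations or workers are orthogonal in `L²`, and so are the new noises to the present gradients.
Squares of damped sums of noises are therefore damped sums of squares, with damping factor
`(1 - α) ^ 2 = 1 - α (2 - α)`, and the total weight `τ / (α (2 - α)) - 1` of such a sum accounts
for the third term of the bound.
-/

namespace OverlapLocalSGD

noncomputable section

/-! ### Averages -/

section Average

variable {ι E : Type*} [Fintype ι]

/-- The arithmetic mean of a finite family of vectors, as a linear map; it is the `(1/m) ∑ i` of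
the algorithm. -/
def mean [AddCommGroup E] [Module ℝ E] : (ι → E) →ₗ[ℝ] E :=
  (1 / (Fintype.card ι : ℝ)) • ∑ i, LinearMap.proj i

/-- The deviations of a finite family of vectors from its mean, as a linear map. -/
def deviation [AddCommGroup E] [Module ℝ E] : (ι → E) →ₗ[ℝ] ι → E :=
  LinearMap.id - LinearMap.pi fun _ => mean

/-- The mean of the squared norms of a finite family of vectors. -/
def meanSq [SeminormedAddCommGroup E] (a : ι → E) : ℝ := mean fun i => ‖a i‖ ^ 2

section Module

variable [AddCommGroup E] [Module ℝ E]

lemma mean_apply (a : ι → E) : mean a = (1 / (Fintype.card ι : ℝ)) • ∑ i, a i := by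
  simp [mean]

lemma deviation_apply (a : ι → E) (i : ι) : deviation a i = a i - mean a := rfl

lemma map_mean {F : Type*} [AddCommGroup F] [Module ℝ F] (T : E →ₗ[ℝ] F) (a : ι → E) :
    T (mean a) = mean fun i => T (a i) := by
  simp only [mean_apply, map_smul, map_sum]

lemma mean_const [Nonempty ι] (c : E) : mean (fun _ : ι => c) = c := by
  simp [mean_apply, ← Nat.cast_smul_eq_nsmul ℝ, smul_smul]

lemma mean_deviation [Nonempty ι] (a : ι → E) : mean (deviation a) = 0 := by
  have h : deviation a = a - fun _ => mean a := rfl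
  rw [h, map_sub, mean_const, sub_self]

lemma deviation_const [Nonempty ι] (c : E) : deviation (fun _ : ι => c) = 0 := by
  funext i
  rw [deviation_apply, mean_const, sub_self, Pi.zero_apply]

end Module

lemma mean_mono {a b : ι → ℝ} (h : ∀ i, a i ≤ b i) : mean a ≤ mean b := by
  simp only [mean_apply]
  gcongr with i
  exact h i

lemma mean_le_of_le [Nonempty ι] {a : ι → ℝ} {c : ℝ} (h : ∀ i, a i ≤ c) : mean a ≤ c :=
  (mean_mono h).trans_eq (mean_const c)

lemma meanSq_nonneg [SeminormedAddCommGroup E] (a : ι → E) : 0 ≤ meanSq a := by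
  rw [meanSq, mean_apply]
  positivity

section InnerProductSpace

variable [NormedAddCommGroup E] [InnerProductSpace ℝ E]

lemma mean_inner_left (a : ι → E) (v : E) :
    mean (fun i => inner ℝ (a i) v) = inner ℝ (mean a) v :=
  (map_mean ((innerₗ E).flip v) a).symm

variable [Nonempty ι]

lemma meanSq_sub_const (a : ι → E) (c : E) :
    meanSq (fun i => a i - c) = meanSq (deviation a) + ‖mean a - c‖ ^ 2 := by
  have expand : (fun i => ‖a i - c‖ ^ 2) = (fun i => ‖deviation a i‖ ^ 2)
      + (2 : ℝ) • (fun i => inner ℝ (deviation a i) (mean a - c))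
      + fun _ => ‖mean a - c‖ ^ 2 := by
    funext i
    rw [← sub_add_sub_cancel (a i) (mean a) c, norm_add_sq_real]
    rfl
  rw [meanSq, expand, map_add, map_add, map_smul, mean_inner_left, mean_deviation,
    inner_zero_left, smul_zero, add_zero, mean_const, meanSq]

lemma meanSq_eq_meanSq_deviation_add (a : ι → E) :
    meanSq a = meanSq (deviation a) + ‖mean a‖ ^ 2 := by
  simpa only [sub_zero] using meanSq_sub_const a 0

lemma norm_mean_sq_le (a : ι → E) : ‖mean a‖ ^ 2 ≤ meanSq a := by
  linarith [meanSq_eq_meanSq_deviation_add a, meanSq_nonneg (deviation a)]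

lemma meanSq_deviation_le (a : ι → E) : meanSq (deviation a) ≤ meanSq a := by
  linarith [meanSq_eq_meanSq_deviation_add a, sq_nonneg ‖mean a‖]

end InnerProductSpace

end Average

lemma norm_add_add_sq_le {E : Type*} [SeminormedAddCommGroup E] (a b c : E) {p q r : ℝ}
    (hp : 0 < p) (hq : 0 < q) (hr : 0 < r) (hpqr : p + q + r = 1) :
    ‖a + b + c‖ ^ 2 ≤ ‖a‖ ^ 2 / p + ‖b‖ ^ 2 / q + ‖c‖ ^ 2 / r := by
  have hweights : ∀ i ∈ Finset.univ, 0 < ![p, q, r] i := by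
    intro i _
    fin_cases i <;> assumption
  have hcs := Finset.sq_sum_div_le_sum_sq_div Finset.univ ![‖a‖, ‖b‖, ‖c‖] hweights
  simp only [Fin.sum_univ_three, Matrix.cons_val, hpqr, div_one] at hcs
  exact (pow_le_pow_left₀ (norm_nonneg _) norm_add₃_le 2).trans hcs

/-! ### Periodically damped sums -/

section Damping

/-- The factor `1 - α` by which the pullback contracts towards the anchor: it acts at the
synchronisation steps, where `τ ∣ k + 1`, and is `1` elsewhere. -/
def damping (α : ℝ) (τ k : ℕ) : ℝ := if (k + 1) % τ = 0 then 1 - α else 1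

/-- The sum of the increments `p 0, …, p (k - 1)`, the partial sum being multiplied by
`damping α τ j` once `p j` has been added. -/
def dampedSum {E : Type*} [AddCommGroup E] [Module ℝ E] (α : ℝ) (τ : ℕ) (p : ℕ → E) : ℕ → E
  | 0 => 0
  | k + 1 => damping α τ k • (dampedSum α τ p k + p k)

/-- The `τ`-periodic solution of the recursion `W (k + 1) = damping α τ k * (W k + 1)` satisfied by
the damped sums of the constant sequence `1`; it dominates all of these. -/
def dampingMass (α : ℝ) (τ k : ℕ) : ℝ := τ * (1 - α) / α + (k % τ : ℕ)

variable {α β : ℝ} {τ : ℕ}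

section Module

variable {E F : Type*} [AddCommGroup E] [Module ℝ E] [AddCommGroup F] [Module ℝ F]

lemma map_dampedSum (T : E →ₗ[ℝ] F) (p : ℕ → E) (k : ℕ) :
    T (dampedSum α τ p k) = dampedSum α τ (fun j => T (p j)) k := by
  induction k with
  | zero => exact map_zero T
  | succ k ih => simp only [dampedSum, map_smul, map_add, ih]

lemma dampedSum_apply {ι : Type*} (p : ℕ → ι → E) (k : ℕ) (i : ι) :
    dampedSum α τ p k i = dampedSum α τ (fun j => p j i) k :=
  map_dampedSum (LinearMap.proj i) p k

lemma dampedSum_add (p q : ℕ → E) (k : ℕ) :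
    dampedSum α τ (fun j => p j + q j) k = dampedSum α τ p k + dampedSum α τ q k := by
  induction k with
  | zero => exact (add_zero 0).symm
  | succ k ih => simp only [dampedSum, ih, ← smul_add, add_add_add_comm]

end Module

lemma damping_nonneg (hα₁ : α ≤ 1) (τ k : ℕ) : 0 ≤ damping α τ k := by
  unfold damping; split_ifs <;> linarith

lemma damping_anti (h : α ≤ β) (τ k : ℕ) : damping β τ k ≤ damping α τ k := by
  unfold damping; split_ifs <;> linarith

lemma damping_sq (α : ℝ) (τ k : ℕ) : damping α τ k ^ 2 = damping (α * (2 - α)) τ k := by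
  unfold damping; split_ifs <;> ring

lemma damping_cases (α : ℝ) (hτ : 0 < τ) (k : ℕ) :
    (damping α τ k = 1 - α ∧ ((k % τ : ℕ) : ℝ) = τ - 1 ∧ (((k + 1) % τ : ℕ) : ℝ) = 0) ∨
    (damping α τ k = 1 ∧ (((k + 1) % τ : ℕ) : ℝ) = (k % τ : ℕ) + 1) := by
  have hmod : (k + 1) % τ = (k % τ + 1) % τ := by simp
  rcases (Nat.add_one_le_of_lt (Nat.mod_lt k hτ)).eq_or_lt with hsync | hlocal
  · left
    have hnext : (k + 1) % τ = 0 := by rw [hmod, hsync, Nat.mod_self]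
    refine ⟨if_pos hnext, ?_, by rw [hnext, Nat.cast_zero]⟩
    rw [eq_sub_iff_add_eq]
    exact_mod_cast hsync
  · right
    have hnext : (k + 1) % τ = k % τ + 1 := hmod.trans (Nat.mod_eq_of_lt hlocal)
    exact ⟨if_neg (by omega), by rw [hnext, Nat.cast_succ]⟩

lemma dampingMass_succ (hα : α ≠ 0) (hτ : 0 < τ) (k : ℕ) :
    dampingMass α τ (k + 1) = damping α τ k * (dampingMass α τ k + 1) := by
  unfold dampingMass
  rcases damping_cases α hτ k with ⟨hρ, hk, hk'⟩ | ⟨hρ, hk'⟩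
  · rw [hρ, hk, hk']; field_simp; ring
  · rw [hρ, hk']; ring

lemma dampingMass_nonneg (hα₀ : 0 ≤ α) (hα₁ : α ≤ 1) (τ k : ℕ) : 0 ≤ dampingMass α τ k := by
  have : 0 ≤ 1 - α := by linarith
  unfold dampingMass
  positivity

lemma dampingMass_le (hα : α ≠ 0) (hτ : 0 < τ) (k : ℕ) : dampingMass α τ k ≤ τ / α - 1 := by
  have hk : ((k % τ : ℕ) : ℝ) + 1 ≤ τ := by exact_mod_cast Nat.mod_lt k hτ
  have : (τ : ℝ) * (1 - α) / α = τ / α - τ := by field_simp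
  unfold dampingMass
  linarith

section Real

variable {a : ℕ → ℝ}

lemma dampedSum_nonneg (hα₁ : α ≤ 1) (ha : ∀ j, 0 ≤ a j) (k : ℕ) : 0 ≤ dampedSum α τ a k := by
  induction k with
  | zero => exact le_rfl
  | succ k ih => exact mul_nonneg (damping_nonneg hα₁ τ k) (add_nonneg ih (ha k))

lemma dampedSum_anti (hαβ : α ≤ β) (hβ₁ : β ≤ 1) (ha : ∀ j, 0 ≤ a j) (k : ℕ) :
    dampedSum β τ a k ≤ dampedSum α τ a k := by
  induction k with
  | zero => exact le_rfl
  | succ k ih =>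
    have := add_nonneg (dampedSum_nonneg (τ := τ) hβ₁ ha k) (ha k)
    have := damping_nonneg (hαβ.trans hβ₁) τ k
    simp only [dampedSum, smul_eq_mul]
    gcongr
    exact damping_anti hαβ τ k

lemma dampedSum_le_mul_dampingMass (hα₀ : 0 < α) (hα₁ : α ≤ 1) (hτ : 0 < τ) {c : ℝ} (hc : 0 ≤ c)
    (ha : ∀ j, a j ≤ c) (k : ℕ) : dampedSum α τ a k ≤ c * dampingMass α τ k := by
  induction k with
  | zero => exact mul_nonneg hc (dampingMass_nonneg hα₀.le hα₁ τ 0)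
  | succ k ih =>
    have := damping_nonneg hα₁ τ k
    calc damping α τ k * (dampedSum α τ a k + a k)
        ≤ damping α τ k * (c * dampingMass α τ k + c) := by gcongr; exact ha k
      _ = c * dampingMass α τ (k + 1) := by rw [dampingMass_succ hα₀.ne' hτ]; ring

/- The weight `τ / α - k % τ` solves the recursion adjoint to that of `dampingMass`. -/
lemma sum_dampedSum_le (hα : α ≠ 0) (hτ : 0 < τ) (ha : ∀ j, 0 ≤ a j) (K : ℕ) :
    ∑ k ∈ Finset.range K, dampedSum α τ a k + (τ / α - (K % τ : ℕ)) * dampedSum α τ a K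
      ≤ τ / α * ∑ k ∈ Finset.range K, a k := by
  induction K with
  | zero => simp [dampedSum]
  | succ k ih =>
    have hadjoint : (τ / α - ((k + 1) % τ : ℕ)) * damping α τ k = τ / α - (k % τ : ℕ) - 1 := by
      rcases damping_cases α hτ k with ⟨hρ, hk, hk'⟩ | ⟨hρ, hk'⟩
      · rw [hρ, hk, hk']; field_simp; ring
      · rw [hρ, hk']; ring
    have hstep : (τ / α - ((k + 1) % τ : ℕ)) * dampedSum α τ a (k + 1)
        = (τ / α - (k % τ : ℕ) - 1) * (dampedSum α τ a k + a k) := by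
      rw [← hadjoint, dampedSum, smul_eq_mul]; ring
    have hpos : 0 ≤ ((k % τ : ℕ) + 1 : ℝ) * a k := mul_nonneg (by positivity) (ha k)
    rw [Finset.sum_range_succ, Finset.sum_range_succ, hstep]
    linarith

lemma add_sq_le_of_sq_le_mul {x y W Q : ℝ} (hW : 0 ≤ W) (hQ : 0 ≤ Q) (h : x ^ 2 ≤ W * Q) :
    (x + y) ^ 2 ≤ (W + 1) * (Q + y ^ 2) := by
  have hcross : 2 * (x * y) ≤ W * y ^ 2 + Q := by
    refine (abs_le_of_sq_le_sq' ?_ (by positivity)).2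
    have := mul_le_mul_of_nonneg_right h (sq_nonneg y)
    nlinarith [sq_nonneg (W * y ^ 2 - Q)]
  linarith

end Real

section Normed

variable {E : Type*} [SeminormedAddCommGroup E] [NormedSpace ℝ E]

lemma norm_dampedSum_sq_le (hα₀ : 0 < α) (hα₁ : α ≤ 1) (hτ : 0 < τ) (p : ℕ → E) (k : ℕ) :
    ‖dampedSum α τ p k‖ ^ 2 ≤ dampingMass α τ k * dampedSum α τ (fun j => ‖p j‖ ^ 2) k := by
  induction k with
  | zero => simp [dampedSum]
  | succ k ih =>
    have hcs : (‖dampedSum α τ p k‖ + ‖p k‖) ^ 2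
        ≤ (dampingMass α τ k + 1) * (dampedSum α τ (fun j => ‖p j‖ ^ 2) k + ‖p k‖ ^ 2) :=
      add_sq_le_of_sq_le_mul (dampingMass_nonneg hα₀.le hα₁ τ k)
        (dampedSum_nonneg hα₁ (fun _ => sq_nonneg _) k) ih
    calc ‖damping α τ k • (dampedSum α τ p k + p k)‖ ^ 2
        = damping α τ k ^ 2 * ‖dampedSum α τ p k + p k‖ ^ 2 := by
          rw [norm_smul, mul_pow, Real.norm_eq_abs, sq_abs]
      _ ≤ damping α τ k ^ 2 * (‖dampedSum α τ p k‖ + ‖p k‖) ^ 2 := by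
          gcongr; exact norm_add_le _ _
      _ ≤ damping α τ k ^ 2 * ((dampingMass α τ k + 1)
            * (dampedSum α τ (fun j => ‖p j‖ ^ 2) k + ‖p k‖ ^ 2)) := by gcongr
      _ = dampingMass α τ (k + 1) * dampedSum α τ (fun j => ‖p j‖ ^ 2) (k + 1) := by
          rw [dampingMass_succ hα₀.ne' hτ, dampedSum, smul_eq_mul]; ring

/- Young's convolution inequality `‖w * p‖₂ ≤ ‖w‖₁ ‖p‖₂`: `τ / α` bounds the total weight both of
the increments entering a partial sum and of the partial sums entered by an increment. -/
lemma sum_norm_dampedSum_sq_le (hα₀ : 0 < α) (hα₁ : α ≤ 1) (hτ : 0 < τ) (p : ℕ → E) (K : ℕ) :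
    ∑ k ∈ Finset.range K, ‖dampedSum α τ p k‖ ^ 2
      ≤ (τ / α) ^ 2 * ∑ k ∈ Finset.range K, ‖p k‖ ^ 2 := by
  have hnonneg : ∀ k, 0 ≤ dampedSum α τ (fun j => ‖p j‖ ^ 2) k :=
    dampedSum_nonneg hα₁ fun _ => sq_nonneg _
  have hmass : ∀ k, dampingMass α τ k ≤ τ / α := fun k =>
    (dampingMass_le hα₀.ne' hτ k).trans (sub_le_self _ zero_le_one)
  have hlast : 0 ≤ (τ / α - (K % τ : ℕ)) * dampedSum α τ (fun j => ‖p j‖ ^ 2) K := by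
    refine mul_nonneg (sub_nonneg.2 ?_) (hnonneg K)
    calc ((K % τ : ℕ) : ℝ) ≤ τ := by exact_mod_cast (Nat.mod_lt K hτ).le
      _ ≤ τ / α := le_div_self τ.cast_nonneg hα₀ hα₁
  calc ∑ k ∈ Finset.range K, ‖dampedSum α τ p k‖ ^ 2
      ≤ ∑ k ∈ Finset.range K, τ / α * dampedSum α τ (fun j => ‖p j‖ ^ 2) k :=
        Finset.sum_le_sum fun k _ => (norm_dampedSum_sq_le hα₀ hα₁ hτ p k).trans
          (mul_le_mul_of_nonneg_right (hmass k) (hnonneg k))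
    _ = τ / α * ∑ k ∈ Finset.range K, dampedSum α τ (fun j => ‖p j‖ ^ 2) k := by
        rw [Finset.mul_sum]
    _ ≤ τ / α * (τ / α * ∑ k ∈ Finset.range K, ‖p k‖ ^ 2) := by
        gcongr
        linarith [sum_dampedSum_le hα₀.ne' hτ (fun j => sq_nonneg ‖p j‖) K]
    _ = (τ / α) ^ 2 * ∑ k ∈ Finset.range K, ‖p k‖ ^ 2 := by ring

end Normed

end Damping

/-! ### Gradient steps on smooth functions -/

section Smooth

variable {E : Type*} [NormedAddCommGroup E] [InnerProductSpace ℝ E] [CompleteSpace E]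
  {F : E → ℝ} {F' : E → E} {L : NNReal}

lemma le_add_inner_add_sq_of_lipschitzWith_gradient (hF : ∀ x, HasGradientAt F (F' x) x)
    (hL : LipschitzWith L F') (x v : E) :
    F (x + v) ≤ F x + inner ℝ (F' x) v + L / 2 * ‖v‖ ^ 2 := by
  have hline : ∀ t : ℝ, HasDerivAt (fun t : ℝ => F (x + t • v)) (inner ℝ (F' (x + t • v)) v) t := by
    intro t
    have hv : HasDerivAt (fun t : ℝ => x + t • v) v t := by
      simpa using ((hasDerivAt_id t).smul_const v).const_add x
    simpa [Function.comp_def] using (hF (x + t • v)).hasFDerivAt.comp_hasDerivAt t hv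
  have hparabola : ∀ t : ℝ, HasDerivAt
      (fun t : ℝ => F x + t * inner ℝ (F' x) v + L / 2 * ‖v‖ ^ 2 * t ^ 2)
      (inner ℝ (F' x) v + L * ‖v‖ ^ 2 * t) t := by
    intro t
    refine ((((hasDerivAt_id t).mul_const (inner ℝ (F' x) v)).const_add (F x)).add
      ((hasDerivAt_pow 2 t).const_mul (L / 2 * ‖v‖ ^ 2))).congr_deriv ?_
    norm_num
    ring
  have hslope : ∀ t ∈ Set.Ico (0 : ℝ) 1,
      inner ℝ (F' (x + t • v)) v ≤ inner ℝ (F' x) v + L * ‖v‖ ^ 2 * t := by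
    intro t ht
    have hlip : ‖F' (x + t • v) - F' x‖ ≤ L * (t * ‖v‖) := by
      have := hL.norm_sub_le (x + t • v) x
      rwa [add_sub_cancel_left, norm_smul, Real.norm_of_nonneg ht.1] at this
    have hinner : inner ℝ (F' (x + t • v) - F' x) v ≤ L * (t * ‖v‖) * ‖v‖ :=
      (real_inner_le_norm _ _).trans (by gcongr)
    rw [inner_sub_left] at hinner
    linarith
  have := image_le_of_deriv_right_le_deriv_boundary
    (fun t _ => (hline t).continuousAt.continuousWithinAt)
    (fun t _ => (hline t).hasDerivWithinAt) (by simp)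
    (fun t _ => (hparabola t).continuousAt.continuousWithinAt)
    (fun t _ => (hparabola t).hasDerivWithinAt) hslope (Set.right_mem_Icc.2 zero_le_one)
  simpa using this

lemma norm_gradient_sq_le_of_step (hF : ∀ x, HasGradientAt F (F' x) x) (hL : LipschitzWith L F')
    {γ : ℝ} (hγ : 0 < γ) (hγL : γ * L ≤ 1 / 2) (y h e : E) :
    ‖F' y‖ ^ 2 ≤ 2 / γ * (F y - F (y - γ • (h + e))) - 1 / 2 * ‖h‖ ^ 2 + ‖F' y - h‖ ^ 2
      + γ * L * ‖e‖ ^ 2 + inner ℝ ((2 * γ * L) • h - (2 : ℝ) • F' y) e := by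
  have hdescent := le_add_inner_add_sq_of_lipschitzWith_gradient hF hL y (-(γ • (h + e)))
  rw [← sub_eq_add_neg, inner_neg_right, real_inner_smul_right, norm_neg, norm_smul, mul_pow,
    Real.norm_eq_abs, sq_abs] at hdescent
  have hdecrease : 2 * inner ℝ (F' y) (h + e) - γ * L * ‖h + e‖ ^ 2
      ≤ 2 / γ * (F y - F (y - γ • (h + e))) := by
    rw [div_mul_eq_mul_div, le_div_iff₀ hγ]
    linarith
  have hhalf := mul_le_mul_of_nonneg_right hγL (sq_nonneg ‖h‖)
  rw [norm_add_sq_real, inner_add_right] at hdecrease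
  rw [norm_sub_sq_real, inner_sub_left, real_inner_smul_left, real_inner_smul_left]
  linarith

end Smooth

section Lipschitz

variable {ι E : Type*} [Fintype ι] [NormedAddCommGroup E] {f : ι → E → E}
  {L : NNReal}

lemma meanSq_map_sub_map_le (hf : ∀ i, LipschitzWith L (f i)) (a b : ι → E) :
    meanSq (Pi.map f a - Pi.map f b) ≤ L ^ 2 * meanSq (a - b) := by
  have hpoint : ∀ i, ‖(Pi.map f a - Pi.map f b) i‖ ^ 2 ≤ L ^ 2 * ‖(a - b) i‖ ^ 2 := by
    intro i
    rw [← mul_pow]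
    exact pow_le_pow_left₀ (norm_nonneg _) ((hf i).norm_sub_le _ _) 2
  exact (mean_mono hpoint).trans_eq (map_smul mean ((L : ℝ) ^ 2) fun i => ‖(a - b) i‖ ^ 2)

variable [InnerProductSpace ℝ E] [Nonempty ι]

lemma norm_mean_map_sub_sq_le (hf : ∀ i, LipschitzWith L (f i)) (a : ι → E) (c : E) :
    ‖mean (fun i => f i c) - mean (Pi.map f a)‖ ^ 2
      ≤ L ^ 2 * (meanSq (deviation a) + ‖mean a - c‖ ^ 2) := by
  rw [norm_sub_rev, ← map_sub, ← meanSq_sub_const]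
  exact (norm_mean_sq_le _).trans (meanSq_map_sub_map_le hf a fun _ => c)

lemma lipschitzWith_mean (hf : ∀ i, LipschitzWith L (f i)) :
    LipschitzWith L fun x => mean fun i => f i x := by
  refine LipschitzWith.of_dist_le_mul fun x y => ?_
  have h := norm_mean_map_sub_sq_le hf (fun _ => y) x
  rw [deviation_const, mean_const, meanSq] at h
  simp only [Pi.zero_apply, norm_zero, ne_eq, OfNat.ofNat_ne_zero, not_false_eq_true, zero_pow,
    mean_const, zero_add, ← mul_pow] at h
  rw [dist_eq_norm, dist_eq_norm, norm_sub_rev x y]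
  exact (abs_le_of_sq_le_sq' h (by positivity)).2

end Lipschitz

/-! ### Overlap-Local-SGD in terms of damped sums -/

/-- The dynamics of Overlap-Local-SGD with local models `x`, virtual model `y` and search
directions `G`, after elimination of the anchor: deviations from the average model are damped by
`α`, whereas the gap between the average model and the virtual model is reset at every
synchronisation step. -/
structure IsOverlapLocalSGD {ι E : Type*} [Fintype ι] [AddCommGroup E] [Module ℝ E] (η α : ℝ)
    (τ : ℕ) (x G : ℕ → ι → E) (y : ℕ → E) : Prop where
  deviation_eq : ∀ k, deviation (x k) = -η • dampedSum α τ (fun j => deviation (G j)) k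
  mean_sub_eq : ∀ k, mean (x k) - y k = -(α * η) • dampedSum 1 τ (fun j => mean (G j)) k
  succ_eq : ∀ k, y (k + 1) = y k - ((1 - α) * η) • mean (G k)

section Iteration

variable {d m : ℕ} {S : Type*}
  (g : Fin m → EuclideanSpace ℝ (Fin d) → S → EuclideanSpace ℝ (Fin d)) (η α : ℝ) (τ : ℕ)
  (x₀ : EuclideanSpace ℝ (Fin d)) (ξ : ℕ → Fin m → S)

/-- The stochastic gradients that the workers use in iteration `k`. -/
def sampledGradient (k : ℕ) (i : Fin m) : EuclideanSpace ℝ (Fin d) :=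
  g i ((iterate g η α τ x₀ ξ k).x i) (ξ k i)

lemma one_div_smul_sum_eq_mean {E : Type*} [AddCommGroup E] [Module ℝ E] (a : Fin m → E) :
    (1 / (m : ℝ)) • ∑ i, a i = mean a := by
  rw [mean_apply, Fintype.card_fin]

lemma virtualModel_eq (s : State d m) : virtualModel α s = (1 - α) • mean s.x + α • s.z := by
  rw [virtualModel, one_div_smul_sum_eq_mean]

lemma iterate_succ_x (k : ℕ) :
    (iterate g η α τ x₀ ξ (k + 1)).x
      = damping α τ k • ((iterate g η α τ x₀ ξ k).x - η • sampledGradient g η α τ x₀ ξ k)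
        + (1 - damping α τ k) • fun _ => (iterate g η α τ x₀ ξ k).z := by
  funext i
  simp only [iterate, step, nextLocal, damping, halfStep, sampledGradient, Pi.add_apply,
    Pi.smul_apply, Pi.sub_apply]
  split_ifs <;> module

lemma iterate_succ_z (k : ℕ) :
    (iterate g η α τ x₀ ξ (k + 1)).z = if (k + 1) % τ = 0 then
      mean (iterate g η α τ x₀ ξ (k + 1)).x else (iterate g η α τ x₀ ξ k).z := by
  simp only [iterate, step, one_div_smul_sum_eq_mean]

variable [Nonempty (Fin m)]

lemma mean_iterate_succ_x (k : ℕ) :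
    mean (iterate g η α τ x₀ ξ (k + 1)).x
      = damping α τ k • (mean (iterate g η α τ x₀ ξ k).x
          - η • mean (sampledGradient g η α τ x₀ ξ k))
        + (1 - damping α τ k) • (iterate g η α τ x₀ ξ k).z := by
  simp only [iterate_succ_x, map_add, map_smul, map_sub, mean_const]

lemma virtualModel_succ (k : ℕ) :
    virtualModel α (iterate g η α τ x₀ ξ (k + 1)) = virtualModel α (iterate g η α τ x₀ ξ k)
      - ((1 - α) * η) • mean (sampledGradient g η α τ x₀ ξ k) := by
  rw [virtualModel_eq, virtualModel_eq, iterate_succ_z, mean_iterate_succ_x, damping]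
  split_ifs <;> module

lemma deviation_iterate_x (k : ℕ) :
    deviation (iterate g η α τ x₀ ξ k).x
      = -η • dampedSum α τ (fun j => deviation (sampledGradient g η α τ x₀ ξ j)) k := by
  induction k with
  | zero => exact (deviation_const x₀).trans (smul_zero (-η)).symm
  | succ k ih =>
    rw [iterate_succ_x, map_add, map_smul, map_smul, deviation_const, map_sub, map_smul, ih,
      dampedSum]
    module

lemma mean_iterate_x_sub_z (k : ℕ) :
    mean (iterate g η α τ x₀ ξ k).x - (iterate g η α τ x₀ ξ k).z
      = -η • dampedSum 1 τ (fun j => mean (sampledGradient g η α τ x₀ ξ j)) k := by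
  induction k with
  | zero => exact (sub_eq_zero.2 (mean_const x₀)).trans (smul_zero (-η)).symm
  | succ k ih =>
    rw [dampedSum, smul_comm, smul_add, ← ih, iterate_succ_z, mean_iterate_succ_x, damping, damping]
    split_ifs <;> module

lemma isOverlapLocalSGD_iterate :
    IsOverlapLocalSGD η α τ (fun k => (iterate g η α τ x₀ ξ k).x) (sampledGradient g η α τ x₀ ξ)
      fun k => virtualModel α (iterate g η α τ x₀ ξ k) where
  deviation_eq := deviation_iterate_x g η α τ x₀ ξ
  mean_sub_eq k := by
    have hgap : mean (iterate g η α τ x₀ ξ k).x - virtualModel α (iterate g η α τ x₀ ξ k)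
        = α • (mean (iterate g η α τ x₀ ξ k).x - (iterate g η α τ x₀ ξ k).z) := by
      rw [virtualModel_eq]; module
    rw [hgap, mean_iterate_x_sub_z, smul_smul, mul_neg]
  succ_eq := virtualModel_succ g η α τ x₀ ξ

end Iteration

/-! ### Bounds along a path -/

section MeanSquare

variable {ι E : Type*} [Fintype ι] [SeminormedAddCommGroup E]

lemma meanSq_add_add_le (a b c : ι → E) {p q r : ℝ} (hp : 0 < p) (hq : 0 < q) (hr : 0 < r)
    (hpqr : p + q + r = 1) :
    meanSq (a + b + c) ≤ meanSq a / p + meanSq b / q + meanSq c / r := by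
  refine (mean_mono fun i => norm_add_add_sq_le (a i) (b i) (c i) hp hq hr hpqr).trans_eq ?_
  have h : (fun i => ‖a i‖ ^ 2 / p + ‖b i‖ ^ 2 / q + ‖c i‖ ^ 2 / r)
      = p⁻¹ • (fun i => ‖a i‖ ^ 2) + q⁻¹ • (fun i => ‖b i‖ ^ 2) + r⁻¹ • fun i => ‖c i‖ ^ 2 := by
    funext i
    simp [div_eq_inv_mul]
  rw [h, map_add, map_add, map_smul, map_smul, map_smul]
  simp only [meanSq, smul_eq_mul, div_eq_inv_mul]

variable [NormedSpace ℝ E] {α : ℝ} {τ : ℕ}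

lemma meanSq_smul (c : ℝ) (a : ι → E) : meanSq (c • a) = c ^ 2 * meanSq a := by
  have h : (fun i => ‖(c • a) i‖ ^ 2) = c ^ 2 • fun i => ‖a i‖ ^ 2 := by
    funext i
    simp [norm_smul, mul_pow]
  rw [meanSq, h, map_smul, smul_eq_mul, meanSq]

lemma sum_meanSq_dampedSum_le (hα₀ : 0 < α) (hα₁ : α ≤ 1) (hτ : 0 < τ) (p : ℕ → ι → E) (K : ℕ) :
    ∑ k ∈ Finset.range K, meanSq (dampedSum α τ p k)
      ≤ (τ / α) ^ 2 * ∑ k ∈ Finset.range K, meanSq (p k) := by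
  simp only [meanSq, ← map_sum, ← smul_eq_mul ((τ / α) ^ 2), ← map_smul]
  refine mean_mono fun i => ?_
  simp only [Finset.sum_apply, Pi.smul_apply, dampedSum_apply]
  exact sum_norm_dampedSum_sq_le hα₀ hα₁ hτ (fun j => p j i) K

end MeanSquare

/-- The contribution of the noises `ε j` of the iterations `j ≤ k` to the squared gradient norm at
iteration `k`: `a` weighs the accumulated noise in the local models, `b` the fresh averaged noise,
and `v` collects all vectors that meet the fresh averaged noise in an inner product. -/
def noiseTerm {ι E : Type*} [Fintype ι] [NormedAddCommGroup E] [InnerProductSpace ℝ E] (α : ℝ)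
    (τ : ℕ) (a b : ℝ) (ε : ℕ → ι → E) (v : E) (k : ℕ) : ℝ :=
  a * (meanSq (dampedSum α τ (fun j => deviation (ε j)) k)
      + ‖dampedSum 1 τ (fun j => mean (ε j)) k‖ ^ 2)
    + b * ‖mean (ε k)‖ ^ 2 + inner ℝ v (mean (ε k))

section Pathwise

variable {ι E : Type*} [Fintype ι] [NormedAddCommGroup E] [InnerProductSpace ℝ E]
  {f : ι → E → E} {L : NNReal} {κ η α : ℝ} {τ : ℕ} {x ε : ℕ → ι → E} {y : ℕ → E}

lemma deviation_map_add_eq (a e : ι → E) :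
    deviation (Pi.map f a + e) = deviation e + deviation (fun i => f i (mean a))
      + deviation (Pi.map f a - Pi.map f fun _ => mean a) := by
  rw [map_add, map_sub]
  change _ = deviation e + deviation (Pi.map f fun _ => mean a) + _
  abel

lemma sum_norm_mean_sub_sq_le (h : IsOverlapLocalSGD η α τ x (fun k => Pi.map f (x k) + ε k) y)
    (hτ : 0 < τ) (K : ℕ) :
    ∑ k ∈ Finset.range K, ‖mean (x k) - y k‖ ^ 2
      ≤ 2 * (α * η) ^ 2 * (∑ k ∈ Finset.range K, ‖dampedSum 1 τ (fun j => mean (ε j)) k‖ ^ 2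
        + τ ^ 2 * ∑ k ∈ Finset.range K, ‖mean (Pi.map f (x k))‖ ^ 2) := by
  set v := fun k => dampedSum 1 τ (fun j => mean (ε j)) k
  set w := fun k => dampedSum 1 τ (fun j => mean (Pi.map f (x j))) k
  have hw : ∑ k ∈ Finset.range K, ‖w k‖ ^ 2
      ≤ τ ^ 2 * ∑ k ∈ Finset.range K, ‖mean (Pi.map f (x k))‖ ^ 2 := by
    simpa only [div_one] using sum_norm_dampedSum_sq_le one_pos le_rfl hτ _ K
  have hpoint : ∀ k, ‖mean (x k) - y k‖ ^ 2 ≤ 2 * (α * η) ^ 2 * (‖v k‖ ^ 2 + ‖w k‖ ^ 2) := by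
    intro k
    have hsum : mean (x k) - y k = -(α * η) • (w k + v k) := by
      simp only [h.mean_sub_eq, map_add, dampedSum_add, w, v]
    have hpar := parallelogram_law_with_norm ℝ (w k) (v k)
    rw [hsum, norm_smul, mul_pow, norm_neg, Real.norm_eq_abs, sq_abs, mul_comm 2, mul_assoc]
    gcongr
    linarith [sq_nonneg ‖w k - v k‖]
  calc ∑ k ∈ Finset.range K, ‖mean (x k) - y k‖ ^ 2
      ≤ ∑ k ∈ Finset.range K, 2 * (α * η) ^ 2 * (‖v k‖ ^ 2 + ‖w k‖ ^ 2) :=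
        Finset.sum_le_sum fun k _ => hpoint k
    _ = 2 * (α * η) ^ 2 * (∑ k ∈ Finset.range K, ‖v k‖ ^ 2
          + ∑ k ∈ Finset.range K, ‖w k‖ ^ 2) := by
        rw [← Finset.mul_sum, Finset.sum_add_distrib]
    _ ≤ _ := by gcongr

variable [Nonempty ι]

/- The three Young weights leave room for a drift term that is at most a tenth of the left-hand
side. -/
lemma sum_meanSq_deviation_le
    (h : IsOverlapLocalSGD η α τ x (fun k => Pi.map f (x k) + ε k) y)
    (hf : ∀ i, LipschitzWith L (f i)) (hκ : ∀ v, meanSq (deviation fun i => f i v) ≤ κ ^ 2)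
    (hα₀ : 0 < α) (hα₁ : α ≤ 1) (hτ : 0 < τ) (hη : 60 * (η * L * (τ / α)) ^ 2 ≤ 1) (K : ℕ) :
    ∑ k ∈ Finset.range K, meanSq (deviation (x k))
      ≤ 4 * η ^ 2 * ∑ k ∈ Finset.range K, meanSq (dampedSum α τ (fun j => deviation (ε j)) k)
        + 2 * η ^ 2 * (τ / α) ^ 2 * (K * κ ^ 2) := by
  set N := fun k => dampedSum α τ (fun j => deviation (ε j)) k
  set R := fun k => dampedSum α τ (fun j => deviation fun i => f i (mean (x j))) k
  set T := fun k =>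
    dampedSum α τ (fun j => deviation (Pi.map f (x j) - Pi.map f fun _ => mean (x j))) k
  set U := ∑ k ∈ Finset.range K, meanSq (deviation (x k))
  have hdissimilarity : ∑ k ∈ Finset.range K, meanSq (R k) ≤ (τ / α) ^ 2 * (K * κ ^ 2) := by
    refine (sum_meanSq_dampedSum_le hα₀ hα₁ hτ _ K).trans ?_
    gcongr
    exact (Finset.sum_le_sum fun k _ => hκ _).trans_eq (by simp)
  have hdrift : ∑ k ∈ Finset.range K, meanSq (T k) ≤ (τ / α) ^ 2 * (L ^ 2 * U) := by
    refine (sum_meanSq_dampedSum_le hα₀ hα₁ hτ _ K).trans ?_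
    gcongr
    simp only [U, Finset.mul_sum]
    gcongr
    exact (meanSq_deviation_le _).trans (meanSq_map_sub_map_le hf _ _)
  have hsplit : ∀ k, meanSq (deviation (x k))
      ≤ η ^ 2 * (meanSq (N k) / (5 / 18) + meanSq (R k) / (5 / 9) + meanSq (T k) / (1 / 6)) := by
    intro k
    have hsum : deviation (x k) = -η • (N k + R k + T k) := by
      simp only [h.deviation_eq, deviation_map_add_eq, dampedSum_add, N, R, T]
    rw [hsum, meanSq_smul, neg_sq]
    gcongr
    exact meanSq_add_add_le _ _ _ (by norm_num) (by norm_num) (by norm_num) (by norm_num)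
  have htotal : U ≤ η ^ 2 * ((∑ k ∈ Finset.range K, meanSq (N k)) / (5 / 18)
      + (∑ k ∈ Finset.range K, meanSq (R k)) / (5 / 9)
      + (∑ k ∈ Finset.range K, meanSq (T k)) / (1 / 6)) := by
    simp only [Finset.sum_div, ← Finset.sum_add_distrib, Finset.mul_sum]
    exact Finset.sum_le_sum fun k _ => hsplit k
  have hU : 0 ≤ U := Finset.sum_nonneg fun k _ => meanSq_nonneg _
  have hdissimilarity' := mul_le_mul_of_nonneg_left hdissimilarity (sq_nonneg η)
  have hdrift' := mul_le_mul_of_nonneg_left hdrift (sq_nonneg η)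
  have htenth := mul_le_mul_of_nonneg_right hη hU
  linarith

lemma sum_norm_mean_map_sub_sq_le
    (h : IsOverlapLocalSGD η α τ x (fun k => Pi.map f (x k) + ε k) y)
    (hf : ∀ i, LipschitzWith L (f i)) (hκ : ∀ v, meanSq (deviation fun i => f i v) ≤ κ ^ 2)
    (hα₀ : 0 < α) (hα₁ : α ≤ 1) (hτ : 0 < τ) (hη : 60 * (η * L * (τ / α)) ^ 2 ≤ 1) (K : ℕ) :
    ∑ k ∈ Finset.range K, ‖mean (fun i => f i (y k)) - mean (Pi.map f (x k))‖ ^ 2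
      ≤ 4 * (η * L) ^ 2 * ∑ k ∈ Finset.range K,
          (meanSq (dampedSum α τ (fun j => deviation (ε j)) k)
            + ‖dampedSum 1 τ (fun j => mean (ε j)) k‖ ^ 2)
        + 2 * (η * L * (τ / α)) ^ 2 * (K * κ ^ 2)
        + 1 / 30 * ∑ k ∈ Finset.range K, ‖mean (Pi.map f (x k))‖ ^ 2 := by
  have hdispersion := sum_meanSq_deviation_le h hf hκ hα₀ hα₁ hτ hη K
  have hgap := sum_norm_mean_sub_sq_le h hτ K
  have hlip : ∑ k ∈ Finset.range K, ‖mean (fun i => f i (y k)) - mean (Pi.map f (x k))‖ ^ 2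
      ≤ L ^ 2 * (∑ k ∈ Finset.range K, meanSq (deviation (x k))
        + ∑ k ∈ Finset.range K, ‖mean (x k) - y k‖ ^ 2) := by
    rw [← Finset.sum_add_distrib, Finset.mul_sum]
    exact Finset.sum_le_sum fun k _ => norm_mean_map_sub_sq_le hf (x k) (y k)
  rw [Finset.sum_add_distrib]
  set V := ∑ k ∈ Finset.range K, ‖dampedSum 1 τ (fun j => mean (ε j)) k‖ ^ 2
  set H := ∑ k ∈ Finset.range K, ‖mean (Pi.map f (x k))‖ ^ 2
  have hnoise : (α * (η * L)) ^ 2 * V ≤ (η * L) ^ 2 * V := by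
    have hV : 0 ≤ V := Finset.sum_nonneg fun _ _ => sq_nonneg _
    rw [mul_pow]
    exact mul_le_mul_of_nonneg_right
      (mul_le_of_le_one_left (sq_nonneg _) (pow_le_one₀ hα₀.le hα₁)) hV
  have hfield : 60 * (α * (η * L * τ)) ^ 2 * H ≤ H := by
    have hH : 0 ≤ H := Finset.sum_nonneg fun _ _ => sq_nonneg _
    refine mul_le_of_le_one_left hH (le_trans ?_ hη)
    have hα : α ^ 2 ≤ (1 / α) ^ 2 := by
      gcongr
      exact hα₁.trans (one_le_one_div hα₀ hα₁)
    calc 60 * (α * (η * L * τ)) ^ 2 = 60 * (α ^ 2 * (η * L * τ) ^ 2) := by rw [mul_pow]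
      _ ≤ 60 * ((1 / α) ^ 2 * (η * L * τ) ^ 2) := by gcongr
      _ = 60 * (η * L * (τ / α)) ^ 2 := by ring
  have hV : 0 ≤ (η * L) ^ 2 * V :=
    mul_nonneg (sq_nonneg _) (Finset.sum_nonneg fun _ _ => sq_nonneg _)
  have hdispersion' := mul_le_mul_of_nonneg_left hdispersion (sq_nonneg (L : ℝ))
  have hgap' := mul_le_mul_of_nonneg_left hgap (sq_nonneg (L : ℝ))
  linarith

lemma mul_le_half_of_sq_mul_div_le (hη₀ : 0 ≤ η) (hα₀ : 0 < α) (hα₁ : α ≤ 1) (hτ : 0 < τ)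
    (hη : 60 * (η * L * (τ / α)) ^ 2 ≤ 1) : η * L ≤ 1 / 2 := by
  have hτα : 1 ≤ τ / α := (one_le_div hα₀).2 (hα₁.trans (by exact_mod_cast hτ))
  have hsmall : η * L * (τ / α) ≤ 1 / 2 :=
    (abs_le_of_sq_le_sq' (by linarith) (by norm_num)).2
  exact (le_mul_of_one_le_right (by positivity) hτα).trans hsmall

variable [CompleteSpace E] {F : E → ℝ}

lemma sum_norm_gradient_sq_le
    (h : IsOverlapLocalSGD η α τ x (fun k => Pi.map f (x k) + ε k) y)
    (hF : ∀ v, HasGradientAt F (mean fun i => f i v) v)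
    (hf : ∀ i, LipschitzWith L (f i)) (hκ : ∀ v, meanSq (deviation fun i => f i v) ≤ κ ^ 2)
    (hα₀ : 0 < α) (hα₁ : α < 1) (hτ : 0 < τ) (hη₀ : 0 < η)
    (hη : 60 * (η * L * (τ / α)) ^ 2 ≤ 1) (K : ℕ) :
    ∑ k ∈ Finset.range K, ‖mean fun i => f i (y k)‖ ^ 2
      ≤ 2 / ((1 - α) * η) * (F (y 0) - F (y K)) + 2 * (η * L * (τ / α)) ^ 2 * (K * κ ^ 2)
        + ∑ k ∈ Finset.range K, noiseTerm α τ (4 * (η * L) ^ 2) ((1 - α) * η * L) ε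
            ((2 * ((1 - α) * η) * L) • mean (Pi.map f (x k)) - (2 : ℝ) • mean fun i => f i (y k))
            k := by
  set γ := (1 - α) * η
  have hγ : 0 < γ := mul_pos (sub_pos.2 hα₁) hη₀
  have hγL : γ * L ≤ 1 / 2 := by
    have hηL := mul_le_half_of_sq_mul_div_le hη₀.le hα₀ hα₁.le hτ hη
    have hnonneg : 0 ≤ α * (η * L) := by positivity
    linarith
  have hstep : ∀ k, ‖mean fun i => f i (y k)‖ ^ 2 ≤ 2 / γ * (F (y k) - F (y (k + 1)))
      - 1 / 2 * ‖mean (Pi.map f (x k))‖ ^ 2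
      + ‖mean (fun i => f i (y k)) - mean (Pi.map f (x k))‖ ^ 2 + γ * L * ‖mean (ε k)‖ ^ 2
      + inner ℝ ((2 * γ * L) • mean (Pi.map f (x k)) - (2 : ℝ) • mean fun i => f i (y k))
        (mean (ε k)) := by
    intro k
    rw [h.succ_eq, map_add]
    exact norm_gradient_sq_le_of_step hF (lipschitzWith_mean hf) hγ hγL _ _ _
  have hsum := Finset.sum_le_sum fun k (_ : k ∈ Finset.range K) => hstep k
  have hgap := sum_norm_mean_map_sub_sq_le h hf hκ hα₀ hα₁.le hτ hη K
  have hH : 0 ≤ ∑ k ∈ Finset.range K, ‖mean (Pi.map f (x k))‖ ^ 2 :=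
    Finset.sum_nonneg fun _ _ => sq_nonneg _
  simp only [noiseTerm, Finset.sum_add_distrib, Finset.sum_sub_distrib, ← Finset.mul_sum]
    at hsum hgap ⊢
  rw [← Finset.sum_sub_distrib, Finset.sum_range_sub'] at hsum
  linarith

end Pathwise

/-! ### Damped sums of orthogonal vectors -/

section Membership

variable {ι M : Type*} [Fintype ι] [AddCommGroup M] [Module ℝ M] (C : Submodule ℝ M)

lemma mean_mem {a : ι → M} (h : ∀ i, a i ∈ C) : mean a ∈ C := by
  rw [mean_apply]
  exact C.smul_mem _ (C.sum_mem fun i _ => h i)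

lemma deviation_mem {a : ι → M} (h : ∀ i, a i ∈ C) (i : ι) : deviation a i ∈ C :=
  C.sub_mem (h i) (mean_mem C h)

lemma dampedSum_mem {α : ℝ} {τ : ℕ} {p : ℕ → M} {k : ℕ} (h : ∀ j < k, p j ∈ C) :
    dampedSum α τ p k ∈ C := by
  induction k with
  | zero => exact C.zero_mem
  | succ k ih =>
    exact C.smul_mem _ (C.add_mem (ih fun j hj => h j (hj.trans k.lt_succ_self))
      (h k k.lt_succ_self))

end Membership

lemma map_dampedSum_deviation {ι M N : Type*} [Fintype ι] [AddCommGroup M] [Module ℝ M]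
    [AddCommGroup N] [Module ℝ N] {α : ℝ} {τ : ℕ} (T : M →ₗ[ℝ] N) (p : ℕ → ι → M) (k : ℕ) :
    (fun i => T (dampedSum α τ (fun j => deviation (p j)) k i))
      = dampedSum α τ (fun j => deviation fun i => T (p j i)) k := by
  funext i
  simp only [dampedSum_apply, map_dampedSum, deviation_apply, map_sub, map_mean]

lemma isOrtho_span_range_of_ne {ι H : Type*} [NormedAddCommGroup H] [InnerProductSpace ℝ H]
    {u : ℕ → ι → H} (hu : Pairwise fun p q : ℕ × ι => inner ℝ (u p.1 p.2) (u q.1 q.2) = 0)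
    {j k : ℕ} (hjk : j ≠ k) :
    Submodule.span ℝ (Set.range (u j)) ⟂ Submodule.span ℝ (Set.range (u k)) := by
  rw [Submodule.isOrtho_span]
  rintro _ ⟨i, rfl⟩ _ ⟨l, rfl⟩
  exact hu (i := (j, i)) (j := (k, l)) (by simp [hjk])

section Orthogonal

variable {ι H : Type*} [Fintype ι] [NormedAddCommGroup H] [InnerProductSpace ℝ H] {α : ℝ} {τ : ℕ}

lemma norm_mean_sq_eq_of_orthogonal {u : ι → H} (hu : Pairwise fun i l => inner ℝ (u i) (u l) = 0) :
    ‖mean u‖ ^ 2 = 1 / Fintype.card ι * meanSq u := by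
  have hinner : ∀ i, inner ℝ (u i) (mean u) = (1 / Fintype.card ι : ℝ) • ‖u i‖ ^ 2 := by
    intro i
    rw [mean_apply, real_inner_smul_right, inner_sum,
      Finset.sum_eq_single i (fun l _ hl => hu hl.symm) (by simp), real_inner_self_eq_norm_sq,
      smul_eq_mul]
  rw [← real_inner_self_eq_norm_sq, ← mean_inner_left]
  simp only [hinner]
  exact map_smul mean _ fun i => ‖u i‖ ^ 2

lemma norm_dampedSum_sq_eq_of_orthogonal {p : ℕ → H}
    (hp : Pairwise fun j k => inner ℝ (p j) (p k) = 0) (k : ℕ) :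
    ‖dampedSum α τ p k‖ ^ 2 = dampedSum (α * (2 - α)) τ (fun j => ‖p j‖ ^ 2) k := by
  induction k with
  | zero => simp [dampedSum]
  | succ k ih =>
    have horth : inner ℝ (dampedSum α τ p k) (p k) = 0 :=
      Submodule.mem_orthogonal_singleton_iff_inner_left.1 <| dampedSum_mem _ fun j hj =>
        Submodule.mem_orthogonal_singleton_iff_inner_left.2 (hp hj.ne)
    rw [dampedSum, dampedSum, norm_smul, mul_pow, Real.norm_eq_abs, sq_abs, damping_sq,
      norm_add_sq_real, horth, ih, mul_zero, add_zero, smul_eq_mul]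

variable {u : ℕ → ι → H}

lemma norm_dampedSum_mean_sq_eq_of_orthogonal
    (hu : Pairwise fun p q : ℕ × ι => inner ℝ (u p.1 p.2) (u q.1 q.2) = 0) (k : ℕ) :
    ‖dampedSum α τ (fun j => mean (u j)) k‖ ^ 2
      = dampedSum (α * (2 - α)) τ (fun j => ‖mean (u j)‖ ^ 2) k :=
  norm_dampedSum_sq_eq_of_orthogonal (fun _ _ hjk => (isOrtho_span_range_of_ne hu hjk).inner_eq
    (mean_mem _ fun l => Submodule.subset_span (Set.mem_range_self l))
    (mean_mem _ fun l => Submodule.subset_span (Set.mem_range_self l))) k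

lemma meanSq_dampedSum_deviation_eq_of_orthogonal
    (hu : Pairwise fun p q : ℕ × ι => inner ℝ (u p.1 p.2) (u q.1 q.2) = 0) (k : ℕ) :
    meanSq (dampedSum α τ (fun j => deviation (u j)) k)
      = dampedSum (α * (2 - α)) τ (fun j => meanSq (deviation (u j))) k := by
  have horth : ∀ i, Pairwise fun j k => inner ℝ (deviation (u j) i) (deviation (u k) i) = 0 :=
    fun i _ _ hjk => (isOrtho_span_range_of_ne hu hjk).inner_eq
      (deviation_mem _ (fun l => Submodule.subset_span (Set.mem_range_self l)) i)
      (deviation_mem _ (fun l => Submodule.subset_span (Set.mem_range_self l)) i)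
  simp only [meanSq, dampedSum_apply, norm_dampedSum_sq_eq_of_orthogonal (horth _)]
  rw [← map_dampedSum]
  congr 1
  funext i
  rw [dampedSum_apply]

/- Resetting instead of damping the averages with the factor `α * (2 - α)` of the deviations can
only decrease them, and with equal factors the two terms recombine to the full noise. -/
lemma meanSq_dampedSum_deviation_add_le_of_orthogonal [Nonempty ι] {s : ℝ}
    (hu : Pairwise fun p q : ℕ × ι => inner ℝ (u p.1 p.2) (u q.1 q.2) = 0)
    (hs : ∀ j i, ‖u j i‖ ^ 2 ≤ s) (hα₀ : 0 < α) (hα₂ : α < 2) (hτ : 0 < τ) (k : ℕ) :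
    meanSq (dampedSum α τ (fun j => deviation (u j)) k)
        + ‖dampedSum 1 τ (fun j => mean (u j)) k‖ ^ 2
      ≤ s * (τ / (α * (2 - α)) - 1) := by
  have hs₀ : 0 ≤ s := (sq_nonneg _).trans (hs 0 (Classical.arbitrary ι))
  have hβ₀ : 0 < α * (2 - α) := mul_pos hα₀ (by linarith)
  have hβ₁ : α * (2 - α) ≤ 1 := by nlinarith [sq_nonneg (1 - α)]
  calc meanSq (dampedSum α τ (fun j => deviation (u j)) k)
        + ‖dampedSum 1 τ (fun j => mean (u j)) k‖ ^ 2
      = dampedSum (α * (2 - α)) τ (fun j => meanSq (deviation (u j))) k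
        + dampedSum 1 τ (fun j => ‖mean (u j)‖ ^ 2) k := by
        rw [meanSq_dampedSum_deviation_eq_of_orthogonal hu,
          norm_dampedSum_mean_sq_eq_of_orthogonal hu]
        norm_num
    _ ≤ dampedSum (α * (2 - α)) τ (fun j => meanSq (deviation (u j))) k
        + dampedSum (α * (2 - α)) τ (fun j => ‖mean (u j)‖ ^ 2) k := by
        gcongr
        exact dampedSum_anti hβ₁ le_rfl (fun _ => sq_nonneg _) k
    _ = dampedSum (α * (2 - α)) τ (fun j => meanSq (u j)) k := by
        simp only [← dampedSum_add, ← meanSq_eq_meanSq_deviation_add]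
    _ ≤ s * dampingMass (α * (2 - α)) τ k :=
        dampedSum_le_mul_dampingMass hβ₀ hβ₁ hτ hs₀ (fun j => mean_le_of_le (hs j)) k
    _ ≤ s * (τ / (α * (2 - α)) - 1) := by
        gcongr
        exact dampingMass_le hβ₀.ne' hτ k

lemma noiseTerm_le_of_orthogonal [Nonempty ι] {s a b : ℝ} {v : H}
    (hu : Pairwise fun p q : ℕ × ι => inner ℝ (u p.1 p.2) (u q.1 q.2) = 0)
    (hs : ∀ j i, ‖u j i‖ ^ 2 ≤ s) (hα₀ : 0 < α) (hα₂ : α < 2) (hτ : 0 < τ) (ha : 0 ≤ a)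
    (hb : 0 ≤ b) {k : ℕ} (hv : ∀ i, inner ℝ v (u k i) = 0) :
    noiseTerm α τ a b u v k
      ≤ a * (s * (τ / (α * (2 - α)) - 1)) + b * (s / Fintype.card ι) := by
  have hmean : ‖mean (u k)‖ ^ 2 ≤ s / Fintype.card ι := by
    rw [norm_mean_sq_eq_of_orthogonal fun i l hil => hu (i := (k, i)) (j := (k, l)) (by simp [hil]),
      one_div_mul_eq_div]
    gcongr
    exact mean_le_of_le (hs k)
  have hcross : inner ℝ v (mean (u k)) = 0 :=
    Submodule.mem_orthogonal_singleton_iff_inner_right.1 <| mean_mem _ fun i =>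
      Submodule.mem_orthogonal_singleton_iff_inner_right.2 (hv i)
  rw [noiseTerm, hcross, add_zero]
  gcongr
  exact meanSq_dampedSum_deviation_add_le_of_orthogonal hu hs hα₀ hα₂ hτ k

end Orthogonal

/-! ### Square-integrable random vectors -/

section SquareIntegrable

variable {Ω ι E : Type*} [MeasurableSpace Ω] [Fintype ι] [NormedAddCommGroup E]
  [InnerProductSpace ℝ E]

/-- The space `ℒ²(P; E)` of square-integrable random vectors. Its elements are functions, not
classes modulo almost everywhere equality, so that they can be evaluated at a point of `Ω`. -/
def squareIntegrable (E : Type*) [NormedAddCommGroup E] [InnerProductSpace ℝ E] (P : Measure Ω) :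
    Submodule ℝ (Ω → E) where
  carrier := {X | MemLp X 2 P}
  zero_mem' := MemLp.zero
  add_mem' := MemLp.add
  smul_mem' c _ hX := hX.const_smul c

variable {P : Measure Ω}

/-- The class of a square-integrable random vector in the Hilbert space `L²(P; E)`. -/
def toL2 : squareIntegrable E P →ₗ[ℝ] Lp E 2 P where
  toFun X := MemLp.toLp X X.2
  map_add' X Y := MemLp.toLp_add X.2 Y.2
  map_smul' c X := MemLp.toLp_const_smul c X.2

/-- The value of a square-integrable random vector at an outcome, as a linear map. -/
def evalAt (ω : Ω) : squareIntegrable E P →ₗ[ℝ] E :=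
  LinearMap.proj ω ∘ₗ (squareIntegrable E P).subtype

lemma integrable_inner_evalAt (X Y : squareIntegrable E P) :
    Integrable (fun ω => inner ℝ (evalAt ω X) (evalAt ω Y)) P := by
  refine (L2.integrable_inner (𝕜 := ℝ) (toL2 X) (toL2 Y)).congr ?_
  filter_upwards [MemLp.coeFn_toLp X.2, MemLp.coeFn_toLp Y.2] with ω hX hY
  exact congrArg₂ (inner ℝ) hX hY

lemma integral_inner_evalAt (X Y : squareIntegrable E P) :
    ∫ ω, inner ℝ (evalAt ω X) (evalAt ω Y) ∂P = inner ℝ (toL2 X) (toL2 Y) := by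
  rw [L2.inner_def]
  refine integral_congr_ae ?_
  filter_upwards [MemLp.coeFn_toLp X.2, MemLp.coeFn_toLp Y.2] with ω hX hY
  exact (congrArg₂ (inner ℝ) hX hY).symm

lemma integrable_norm_evalAt_sq (X : squareIntegrable E P) :
    Integrable (fun ω => ‖evalAt ω X‖ ^ 2) P := by
  simpa only [real_inner_self_eq_norm_sq] using integrable_inner_evalAt X X

lemma integral_norm_evalAt_sq (X : squareIntegrable E P) :
    ∫ ω, ‖evalAt ω X‖ ^ 2 ∂P = ‖toL2 X‖ ^ 2 := by
  simpa only [real_inner_self_eq_norm_sq] using integral_inner_evalAt X X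

lemma integrable_meanSq_evalAt (a : ι → squareIntegrable E P) :
    Integrable (fun ω => meanSq fun i => evalAt ω (a i)) P := by
  simp only [meanSq, mean_apply, smul_eq_mul]
  exact (integrable_finsetSum _ fun i _ => integrable_norm_evalAt_sq (a i)).const_mul _

lemma integral_meanSq_evalAt (a : ι → squareIntegrable E P) :
    ∫ ω, meanSq (fun i => evalAt ω (a i)) ∂P = meanSq fun i => toL2 (a i) := by
  simp only [meanSq, mean_apply]
  rw [integral_smul, integral_finsetSum _ fun i _ => integrable_norm_evalAt_sq (a i)]
  simp only [integral_norm_evalAt_sq]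

variable {α : ℝ} {τ : ℕ} {e : ℕ → ι → squareIntegrable E P} {V : squareIntegrable E P}

lemma noiseTerm_evalAt (a b : ℝ) (k : ℕ) (ω : Ω) :
    noiseTerm α τ a b (fun j i => evalAt ω (e j i)) (evalAt ω V) k
      = a * (meanSq (fun i => evalAt ω (dampedSum α τ (fun j => deviation (e j)) k i))
          + ‖evalAt ω (dampedSum 1 τ (fun j => mean (e j)) k)‖ ^ 2)
        + b * ‖evalAt ω (mean (e k))‖ ^ 2 + inner ℝ (evalAt ω V) (evalAt ω (mean (e k))) := by
  rw [map_dampedSum_deviation, map_dampedSum, map_mean]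
  simp only [map_mean, noiseTerm]

lemma integrable_noiseTerm_evalAt (a b : ℝ) (k : ℕ) :
    Integrable (fun ω => noiseTerm α τ a b (fun j i => evalAt ω (e j i)) (evalAt ω V) k) P := by
  simp only [noiseTerm_evalAt]
  exact ((((integrable_meanSq_evalAt _).add (integrable_norm_evalAt_sq _)).const_mul a).add
    ((integrable_norm_evalAt_sq _).const_mul b)).add (integrable_inner_evalAt _ _)

lemma integral_noiseTerm_evalAt (a b : ℝ) (k : ℕ) :
    ∫ ω, noiseTerm α τ a b (fun j i => evalAt ω (e j i)) (evalAt ω V) k ∂P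
      = noiseTerm α τ a b (fun j i => toL2 (e j i)) (toL2 V) k := by
  set A := dampedSum α τ (fun j => deviation (e j)) k with hA
  set B := dampedSum 1 τ (fun j => mean (e j)) k with hB
  have hdamped : Integrable
      (fun ω => a * (meanSq (fun i => evalAt ω (A i)) + ‖evalAt ω B‖ ^ 2)) P :=
    ((integrable_meanSq_evalAt A).add (integrable_norm_evalAt_sq B)).const_mul a
  have hmean : Integrable (fun ω => b * ‖evalAt ω (mean (e k))‖ ^ 2) P :=
    (integrable_norm_evalAt_sq _).const_mul b
  have hsquares : Integrable (fun ω => a * (meanSq (fun i => evalAt ω (A i)) + ‖evalAt ω B‖ ^ 2)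
      + b * ‖evalAt ω (mean (e k))‖ ^ 2) P := hdamped.add hmean
  simp only [noiseTerm_evalAt]
  rw [integral_add hsquares (integrable_inner_evalAt _ _), integral_add hdamped hmean,
    integral_const_mul, integral_const_mul,
    integral_add (integrable_meanSq_evalAt A) (integrable_norm_evalAt_sq B),
    integral_meanSq_evalAt, integral_norm_evalAt_sq, integral_norm_evalAt_sq,
    integral_inner_evalAt, hA, hB, map_dampedSum_deviation, map_dampedSum, map_mean]
  simp only [map_mean, noiseTerm]

end SquareIntegrable

/-! ### Stochastic gradients at random points -/

section IndependentSample

variable {Ω A S : Type*} [MeasurableSpace Ω] [MeasurableSpace A] [MeasurableSpace S]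
  {P : Measure Ω} [IsProbabilityMeasure P] {U : Ω → A} {ζ : Ω → S} {Φ : A × S → ℝ}

lemma measurePreserving_prodMk_of_indepFun (hU : Measurable U) (hζ : Measurable ζ)
    (hind : IndepFun U ζ P) :
    MeasurePreserving (fun ω => (U ω, ζ ω)) P ((P.map U).prod (P.map ζ)) :=
  ⟨hU.prodMk hζ,
    (indepFun_iff_map_prod_eq_prod_map_map hU.aemeasurable hζ.aemeasurable).1 hind⟩

lemma integrable_comp_of_indepFun (hΦ : Measurable Φ) (hU : Measurable U) (hζ : Measurable ζ)
    (hind : IndepFun U ζ P) {c : ℝ} (hint : ∀ u, Integrable (fun s => Φ (u, s)) (P.map ζ))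
    (hc : ∀ u, ∫ s, ‖Φ (u, s)‖ ∂(P.map ζ) ≤ c) : Integrable (fun ω => Φ (U ω, ζ ω)) P := by
  have := Measure.isProbabilityMeasure_map (μ := P) hU.aemeasurable
  refine ((measurePreserving_prodMk_of_indepFun hU hζ hind).integrable_comp
    hΦ.aestronglyMeasurable).2 ((integrable_prod_iff hΦ.aestronglyMeasurable).2
    ⟨ae_of_all _ hint, Integrable.of_bound (C := c)
      hΦ.norm.stronglyMeasurable.integral_prod_right'.aestronglyMeasurable
      (ae_of_all _ fun u => ?_)⟩)
  rw [Real.norm_of_nonneg (integral_nonneg fun _ => norm_nonneg _)]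
  exact hc u

lemma integral_comp_of_indepFun (hΦ : Measurable Φ) (hU : Measurable U) (hζ : Measurable ζ)
    (hind : IndepFun U ζ P) (hint : Integrable (fun ω => Φ (U ω, ζ ω)) P) :
    ∫ ω, Φ (U ω, ζ ω) ∂P = ∫ ω, ∫ s, Φ (U ω, s) ∂(P.map ζ) ∂P := by
  have hprod := measurePreserving_prodMk_of_indepFun hU hζ hind
  rw [← integral_map hprod.measurable.aemeasurable hΦ.aestronglyMeasurable, hprod.map_eq,
    integral_prod _ ((hprod.integrable_comp hΦ.aestronglyMeasurable).1 hint),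
    integral_map hU.aemeasurable
      hΦ.stronglyMeasurable.integral_prod_right'.aestronglyMeasurable]

end IndependentSample

/-- `G x s` is an unbiased estimate of `f x`, for a sample `s` from `D`, whose variance is at most
`σ²` at every point `x`. -/
structure IsStochasticGradient {S E : Type*} [MeasurableSpace S] [NormedAddCommGroup E]
    [NormedSpace ℝ E] [MeasurableSpace E] (G : E → S → E) (f : E → E) (σ : ℝ) (D : Measure S) :
    Prop where
  measurable : Measurable (Function.uncurry G)
  integrable : ∀ x, Integrable (G x) D
  integral_eq : ∀ x, ∫ s, G x s ∂D = f x
  integrable_norm_sub_sq : ∀ x, Integrable (fun s => ‖G x s - f x‖ ^ 2) D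
  integral_norm_sub_sq_le : ∀ x, ∫ s, ‖G x s - f x‖ ^ 2 ∂D ≤ σ ^ 2

section Noise

variable {Ω S E : Type*} [MeasurableSpace Ω] [MeasurableSpace S] [NormedAddCommGroup E]
  [InnerProductSpace ℝ E] [SecondCountableTopology E] [MeasurableSpace E] [BorelSpace E]
  {P : Measure Ω} [IsProbabilityMeasure P] {G : E → S → E} {f : E → E} {σ : ℝ} {X : Ω → E}
  {ζ : Ω → S}

lemma IsStochasticGradient.measurable_expectation {D : Measure S} [SFinite D]
    (h : IsStochasticGradient G f σ D) : Measurable f := by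
  simpa only [h.integral_eq] using
    (h.measurable.stronglyMeasurable.integral_prod_right (ν := D)).measurable

lemma IsStochasticGradient.measurable_sub {D : Measure S} [SFinite D]
    (h : IsStochasticGradient G f σ D) : Measurable fun q : E × S => G q.1 q.2 - f q.1 :=
  h.measurable.sub (h.measurable_expectation.comp measurable_fst)

lemma integrable_norm_noise_sq (h : IsStochasticGradient G f σ (P.map ζ)) (hX : Measurable X)
    (hζ : Measurable ζ) (hind : IndepFun X ζ P) :
    Integrable (fun ω => ‖G (X ω) (ζ ω) - f (X ω)‖ ^ 2) P := by
  refine integrable_comp_of_indepFun (Φ := fun q => ‖G q.1 q.2 - f q.1‖ ^ 2)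
    (h.measurable_sub.norm.pow_const 2) hX hζ hind h.integrable_norm_sub_sq (c := σ ^ 2) ?_
  simpa only [norm_pow, norm_norm] using h.integral_norm_sub_sq_le

lemma memLp_noise (h : IsStochasticGradient G f σ (P.map ζ)) (hX : Measurable X)
    (hζ : Measurable ζ) (hind : IndepFun X ζ P) :
    MemLp (fun ω => G (X ω) (ζ ω) - f (X ω)) 2 P :=
  (memLp_two_iff_integrable_sq_norm
    (h.measurable_sub.comp (hX.prodMk hζ)).aestronglyMeasurable).2
    (integrable_norm_noise_sq h hX hζ hind)

lemma integral_norm_noise_sq_le (h : IsStochasticGradient G f σ (P.map ζ)) (hX : Measurable X)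
    (hζ : Measurable ζ) (hind : IndepFun X ζ P) :
    ∫ ω, ‖G (X ω) (ζ ω) - f (X ω)‖ ^ 2 ∂P ≤ σ ^ 2 := by
  rw [integral_comp_of_indepFun (Φ := fun q => ‖G q.1 q.2 - f q.1‖ ^ 2)
    (h.measurable_sub.norm.pow_const 2) hX hζ hind (integrable_norm_noise_sq h hX hζ hind)]
  refine (integral_mono_of_nonneg (ae_of_all _ fun ω => integral_nonneg fun s => sq_nonneg _)
    (integrable_const (σ ^ 2)) (ae_of_all _ fun ω => h.integral_norm_sub_sq_le (X ω))).trans_eq ?_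
  simp

lemma integral_inner_noise_eq_zero [CompleteSpace E] (h : IsStochasticGradient G f σ (P.map ζ))
    (hX : Measurable X) (hζ : Measurable ζ) {V : Ω → E} (hV : Measurable V)
    (hind : IndepFun (fun ω => (X ω, V ω)) ζ P) (hV2 : MemLp V 2 P) :
    ∫ ω, inner ℝ (V ω) (G (X ω) (ζ ω) - f (X ω)) ∂P = 0 := by
  have := Measure.isProbabilityMeasure_map (μ := P) hζ.aemeasurable
  have hε := memLp_noise h hX hζ (hind.comp measurable_fst measurable_id)
  have hmean : ∀ x, ∫ s, (G x s - f x) ∂(P.map ζ) = 0 := by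
    intro x
    rw [integral_sub (h.integrable x) (integrable_const _), h.integral_eq]
    simp
  have hΦ : Measurable fun q : (E × E) × S => inner ℝ q.1.2 (G q.1.1 q.2 - f q.1.1) :=
    (measurable_snd.comp measurable_fst).inner
      (h.measurable_sub.comp ((measurable_fst.comp measurable_fst).prodMk measurable_snd))
  refine (integral_comp_of_indepFun hΦ (hX.prodMk hV) hζ hind
    (integrable_inner_evalAt (P := P) ⟨V, hV2⟩ ⟨_, hε⟩)).trans ?_
  have hinner : ∀ ω, ∫ s, inner ℝ (V ω) (G (X ω) s - f (X ω)) ∂(P.map ζ) = 0 := by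
    intro ω
    rw [integral_inner (f := fun s => G (X ω) s - f (X ω))
      ((h.integrable _).sub (integrable_const _)), hmean, inner_zero_right]
  simp only [hinner, integral_zero]

end Noise

/-! ### Independent samples -/

section Sampling

variable {Ω ι S A : Type*} [MeasurableSpace S] [MeasurableSpace A]

/-- The information in all samples but the one with index `q`. -/
@[reducible] def otherSamples (ζ : ι → Ω → S) (q : ι) : MeasurableSpace Ω :=
  ⨆ p ∈ ({q}ᶜ : Set ι), MeasurableSpace.comap (ζ p) inferInstance

lemma measurable_otherSamples (ζ : ι → Ω → S) {p q : ι} (hpq : p ≠ q) :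
    Measurable[otherSamples ζ q] (ζ p) :=
  measurable_iff_comap_le.2 (le_iSup₂_of_le
    (f := fun p (_ : p ∈ ({q}ᶜ : Set ι)) => MeasurableSpace.comap (ζ p) inferInstance) p hpq le_rfl)

lemma indepFun_of_measurable_otherSamples [MeasurableSpace Ω] {P : Measure Ω} {ζ : ι → Ω → S}
    (hζ : ∀ p, Measurable (ζ p)) (hind : iIndepFun ζ P) {q : ι} {U : Ω → A}
    (hU : Measurable[otherSamples ζ q] U) : IndepFun U (ζ q) P := by
  have h := indep_iSup_of_disjoint (fun p => (hζ p).comap_le) hind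
    (disjoint_compl_left : Disjoint ({q}ᶜ : Set ι) {q})
  rw [iSup_singleton] at h
  exact (IndepFun_iff_Indep _ _ _).2
    (indep_of_indep_of_le_left h (measurable_iff_comap_le.1 hU))

end Sampling

/-- `ξ ω k i` is the sample that worker `i` draws in iteration `k` at the outcome `ω`; it has the
law `D i`, independently over iterations and workers. -/
structure IsIndepSampling {Ω ι S : Type*} [MeasurableSpace Ω] [MeasurableSpace S]
    (ξ : Ω → ℕ → ι → S) (D : ι → Measure S) (P : Measure Ω) : Prop where
  measurable : ∀ k i, Measurable fun ω => ξ ω k i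
  map_eq : ∀ k i, P.map (fun ω => ξ ω k i) = D i
  iIndepFun : iIndepFun (fun (p : ℕ × ι) ω => ξ ω p.1 p.2) P

section Sampling

variable {Ω ι S A : Type*} [MeasurableSpace S] [MeasurableSpace A]

lemma measurable_otherSamples_of_lt (ξ : Ω → ℕ → ι → S) (k : ℕ) (i : ι) :
    ∀ j < k, ∀ l, Measurable[otherSamples (fun (p : ℕ × ι) ω => ξ ω p.1 p.2) (k, i)]
      fun ω => ξ ω j l := fun j hj l =>
  measurable_otherSamples (fun (p : ℕ × ι) ω => ξ ω p.1 p.2) (p := (j, l))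
    fun h => hj.ne (congrArg Prod.fst h)

lemma IsIndepSampling.indepFun [MeasurableSpace Ω] {P : Measure Ω} {D : ι → Measure S}
    {ξ : Ω → ℕ → ι → S} (hξ : IsIndepSampling ξ D P) {k : ℕ} {i : ι} {U : Ω → A}
    (hU : Measurable[otherSamples (fun (p : ℕ × ι) ω => ξ ω p.1 p.2) (k, i)] U) :
    IndepFun U (fun ω => ξ ω k i) P :=
  indepFun_of_measurable_otherSamples (ζ := fun (p : ℕ × ι) ω => ξ ω p.1 p.2) (q := (k, i))
    (fun p => hξ.measurable p.1 p.2) hξ.iIndepFun hU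

lemma IsIndepSampling.measurable_of_otherSamples [MeasurableSpace Ω] {P : Measure Ω}
    {D : ι → Measure S} {ξ : Ω → ℕ → ι → S} (hξ : IsIndepSampling ξ D P) {q : ℕ × ι} {U : Ω → A}
    (hU : Measurable[otherSamples (fun (p : ℕ × ι) ω => ξ ω p.1 p.2) q] U) : Measurable U :=
  hU.mono (iSup₂_le fun p _ => (hξ.measurable p.1 p.2).comap_le) le_rfl

end Sampling

/-! ### The random run -/

/-- The space of measurable random vectors, for an explicit `σ`-algebra on the outcomes. -/
def measurableFunctions {Ω : Type*} (mΩ : MeasurableSpace Ω) (E : Type*) [NormedAddCommGroup E]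
    [NormedSpace ℝ E] [SecondCountableTopology E] [MeasurableSpace E] [BorelSpace E] :
    Submodule ℝ (Ω → E) where
  carrier := {X | Measurable[mΩ] X}
  zero_mem' := measurable_zero
  add_mem' := Measurable.add
  smul_mem' c _ hX := hX.const_smul c

/-- The errors of the stochastic gradients used in iteration `k` as estimates of the values of
the vector fields `f i` at the local models. -/
def gradientNoise {d m : ℕ} {S : Type*}
    (g : Fin m → EuclideanSpace ℝ (Fin d) → S → EuclideanSpace ℝ (Fin d))
    (f : Fin m → EuclideanSpace ℝ (Fin d) → EuclideanSpace ℝ (Fin d)) (η α : ℝ) (τ : ℕ)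
    (x₀ : EuclideanSpace ℝ (Fin d)) (ξ : ℕ → Fin m → S) (k : ℕ) (i : Fin m) :
    EuclideanSpace ℝ (Fin d) :=
  sampledGradient g η α τ x₀ ξ k i - f i ((iterate g η α τ x₀ ξ k).x i)

section Membership

variable {Ω S : Type*} {d m : ℕ}
  {g : Fin m → EuclideanSpace ℝ (Fin d) → S → EuclideanSpace ℝ (Fin d)} {η α : ℝ} {τ : ℕ}
  {x₀ : EuclideanSpace ℝ (Fin d)} {ξ : Ω → ℕ → Fin m → S}
  {C : Submodule ℝ (Ω → EuclideanSpace ℝ (Fin d))}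

lemma mean_comp_mem {ι : Type*} [Fintype ι] {X : Ω → ι → EuclideanSpace ℝ (Fin d)}
    (hX : ∀ i, (fun ω => X ω i) ∈ C) : (fun ω => mean (X ω)) ∈ C := by
  have h : (fun ω => mean (X ω)) = mean fun i ω => X ω i :=
    funext fun ω => (map_mean (LinearMap.proj ω) fun i ω => X ω i).symm
  exact h ▸ mean_mem C hX

lemma iterate_mem (hx₀ : (fun _ => x₀) ∈ C) (k : ℕ)
    (hG : ∀ j < k, (∀ i, (fun ω => (iterate g η α τ x₀ (ξ ω) j).x i) ∈ C) →
      ∀ i, (fun ω => sampledGradient g η α τ x₀ (ξ ω) j i) ∈ C) :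
    (∀ i, (fun ω => (iterate g η α τ x₀ (ξ ω) k).x i) ∈ C) ∧
      (fun ω => (iterate g η α τ x₀ (ξ ω) k).z) ∈ C := by
  induction k with
  | zero => exact ⟨fun _ => hx₀, hx₀⟩
  | succ k ih =>
    obtain ⟨hx, hz⟩ := ih fun j hj => hG j (hj.trans k.lt_succ_self)
    have hx' : ∀ i, (fun ω => (iterate g η α τ x₀ (ξ ω) (k + 1)).x i) ∈ C := by
      intro i
      simp only [iterate_succ_x]
      exact C.add_mem (C.smul_mem _ (C.sub_mem (hx i)
        (C.smul_mem _ (hG k k.lt_succ_self hx i)))) (C.smul_mem _ hz)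
    refine ⟨hx', ?_⟩
    simp only [iterate_succ_z]
    split_ifs
    · exact mean_comp_mem hx'
    · exact hz

lemma virtualModel_mem {s : Ω → State d m} (hx : ∀ i, (fun ω => (s ω).x i) ∈ C)
    (hz : (fun ω => (s ω).z) ∈ C) : (fun ω => virtualModel α (s ω)) ∈ C := by
  simp only [virtualModel_eq]
  exact C.add_mem (C.smul_mem _ (mean_comp_mem hx)) (C.smul_mem _ hz)

lemma smul_mean_map_sub_mem
    {f : Fin m → EuclideanSpace ℝ (Fin d) → EuclideanSpace ℝ (Fin d)} {s : Ω → State d m}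
    (hf : ∀ i X, X ∈ C → (fun ω => f i (X ω)) ∈ C) (hx : ∀ i, (fun ω => (s ω).x i) ∈ C)
    (hz : (fun ω => (s ω).z) ∈ C) (a b : ℝ) :
    (fun ω => a • mean (Pi.map f (s ω).x) - b • mean fun i => f i (virtualModel α (s ω))) ∈ C :=
  C.sub_mem (C.smul_mem a (mean_comp_mem fun i => hf i _ (hx i)))
    (C.smul_mem b (mean_comp_mem fun i => hf i _ (virtualModel_mem hx hz)))

end Membership

section Run

variable {Ω S : Type*} [MeasurableSpace S] {d m : ℕ}
  {g : Fin m → EuclideanSpace ℝ (Fin d) → S → EuclideanSpace ℝ (Fin d)}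
  {f : Fin m → EuclideanSpace ℝ (Fin d) → EuclideanSpace ℝ (Fin d)}
  {η α σ : ℝ} {τ : ℕ} {x₀ : EuclideanSpace ℝ (Fin d)} {ξ : Ω → ℕ → Fin m → S}
  {D : Fin m → Measure S}

section Measurability

variable [mΩ : MeasurableSpace Ω]

lemma iterate_mem_measurableFunctions (hg : ∀ i, Measurable (Function.uncurry (g i))) (k : ℕ)
    (hξ : ∀ j < k, ∀ i, Measurable fun ω => ξ ω j i) :
    (∀ i, (fun ω => (iterate g η α τ x₀ (ξ ω) k).x i) ∈ measurableFunctions mΩ _) ∧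
      (fun ω => (iterate g η α τ x₀ (ξ ω) k).z) ∈ measurableFunctions mΩ _ :=
  iterate_mem measurable_const k fun j hj hx i => (hg i).comp ((hx i).prodMk (hξ j hj i))

lemma measurable_gradientNoise (hg : ∀ i, Measurable (Function.uncurry (g i)))
    (hf : ∀ i, Measurable (f i)) (k : ℕ) (hξ : ∀ j < k, ∀ i, Measurable fun ω => ξ ω j i)
    (i : Fin m) (hξk : Measurable fun ω => ξ ω k i) :
    Measurable fun ω => gradientNoise g f η α τ x₀ (ξ ω) k i :=
  have hx := (iterate_mem_measurableFunctions hg k hξ).1 i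
  ((hg i).comp (hx.prodMk hξk)).sub ((hf i).comp hx)

end Measurability

lemma measurable_otherSamples_iterate_x (hg : ∀ i, Measurable (Function.uncurry (g i))) (k : ℕ)
    (i : Fin m) : Measurable[otherSamples (fun (p : ℕ × Fin m) ω => ξ ω p.1 p.2) (k, i)]
      fun ω => (iterate g η α τ x₀ (ξ ω) k).x i :=
  (iterate_mem_measurableFunctions (mΩ := otherSamples _ (k, i)) hg k
    (measurable_otherSamples_of_lt ξ k i)).1 i

variable [MeasurableSpace Ω] {P : Measure Ω}

lemma measurable_iterate_x (hg : ∀ i, Measurable (Function.uncurry (g i)))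
    (hξ : IsIndepSampling ξ D P) (k : ℕ) (i : Fin m) :
    Measurable fun ω => (iterate g η α τ x₀ (ξ ω) k).x i :=
  hξ.measurable_of_otherSamples (measurable_otherSamples_iterate_x hg k i)

lemma indepFun_iterate_x (hg : ∀ i, Measurable (Function.uncurry (g i)))
    (hξ : IsIndepSampling ξ D P) (k : ℕ) (i : Fin m) :
    IndepFun (fun ω => (iterate g η α τ x₀ (ξ ω) k).x i) (fun ω => ξ ω k i) P :=
  hξ.indepFun (measurable_otherSamples_iterate_x hg k i)

lemma isStochasticGradient_map (hg : ∀ i, IsStochasticGradient (g i) (f i) σ (D i))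
    (hξ : IsIndepSampling ξ D P) (k : ℕ) (i : Fin m) :
    IsStochasticGradient (g i) (f i) σ (P.map fun ω => ξ ω k i) :=
  (hξ.map_eq k i).symm ▸ hg i

variable [IsProbabilityMeasure P]

lemma memLp_gradientNoise (hg : ∀ i, IsStochasticGradient (g i) (f i) σ (D i))
    (hξ : IsIndepSampling ξ D P) (k : ℕ) (i : Fin m) :
    MemLp (fun ω => gradientNoise g f η α τ x₀ (ξ ω) k i) 2 P :=
  memLp_noise (isStochasticGradient_map hg hξ k i)
    (measurable_iterate_x (fun l => (hg l).measurable) hξ k i) (hξ.measurable k i)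
    (indepFun_iterate_x (fun l => (hg l).measurable) hξ k i)

lemma integral_norm_gradientNoise_sq_le (hg : ∀ i, IsStochasticGradient (g i) (f i) σ (D i))
    (hξ : IsIndepSampling ξ D P) (k : ℕ) (i : Fin m) :
    ∫ ω, ‖gradientNoise g f η α τ x₀ (ξ ω) k i‖ ^ 2 ∂P ≤ σ ^ 2 :=
  integral_norm_noise_sq_le (isStochasticGradient_map hg hξ k i)
    (measurable_iterate_x (fun l => (hg l).measurable) hξ k i) (hξ.measurable k i)
    (indepFun_iterate_x (fun l => (hg l).measurable) hξ k i)

lemma integral_inner_gradientNoise_eq_zero (hg : ∀ i, IsStochasticGradient (g i) (f i) σ (D i))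
    (hξ : IsIndepSampling ξ D P) {k : ℕ} {i : Fin m} {V : Ω → EuclideanSpace ℝ (Fin d)}
    (hV : Measurable[otherSamples (fun (p : ℕ × Fin m) ω => ξ ω p.1 p.2) (k, i)] V)
    (hV2 : MemLp V 2 P) :
    ∫ ω, inner ℝ (V ω) (gradientNoise g f η α τ x₀ (ξ ω) k i) ∂P = 0 := by
  have hgm := fun l => (hg l).measurable
  exact integral_inner_noise_eq_zero (isStochasticGradient_map hg hξ k i)
    (measurable_iterate_x hgm hξ k i) (hξ.measurable k i) (hξ.measurable_of_otherSamples hV)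
    (hξ.indepFun ((measurable_otherSamples_iterate_x hgm k i).prodMk hV)) hV2

lemma integral_inner_gradientNoise_of_le_of_ne
    (hg : ∀ i, IsStochasticGradient (g i) (f i) σ (D i)) (hξ : IsIndepSampling ξ D P) {j k : ℕ}
    {i l : Fin m} (hjk : j ≤ k) (hne : (j, i) ≠ (k, l)) :
    ∫ ω, inner ℝ (gradientNoise g f η α τ x₀ (ξ ω) j i) (gradientNoise g f η α τ x₀ (ξ ω) k l) ∂P
      = 0 := by
  refine integral_inner_gradientNoise_eq_zero hg hξ ?_ (memLp_gradientNoise hg hξ j i)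
  have hf := fun l => (isStochasticGradient_map hg hξ j l).measurable_expectation
  exact measurable_gradientNoise (mΩ := otherSamples _ (k, l)) (fun l => (hg l).measurable) hf j
    (fun j' hj' => measurable_otherSamples_of_lt ξ k l j' (hj'.trans_le hjk)) i
    (measurable_otherSamples (fun (p : ℕ × Fin m) ω => ξ ω p.1 p.2) (p := (j, i)) hne)

lemma integral_inner_gradientNoise_of_ne (hg : ∀ i, IsStochasticGradient (g i) (f i) σ (D i))
    (hξ : IsIndepSampling ξ D P) {p q : ℕ × Fin m} (hpq : p ≠ q) :
    ∫ ω, inner ℝ (gradientNoise g f η α τ x₀ (ξ ω) p.1 p.2)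
      (gradientNoise g f η α τ x₀ (ξ ω) q.1 q.2) ∂P = 0 := by
  rcases le_total p.1 q.1 with h | h
  · exact integral_inner_gradientNoise_of_le_of_ne hg hξ h hpq
  · simp only [real_inner_comm (gradientNoise g f η α τ x₀ _ q.1 q.2)]
    exact integral_inner_gradientNoise_of_le_of_ne hg hξ h hpq.symm

/-- The gradient noise as a square-integrable random vector. -/
def gradientNoiseL2 (hg : ∀ i, IsStochasticGradient (g i) (f i) σ (D i))
    (hξ : IsIndepSampling ξ D P) (η α : ℝ) (τ : ℕ) (x₀ : EuclideanSpace ℝ (Fin d)) (k : ℕ)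
    (i : Fin m) : squareIntegrable (EuclideanSpace ℝ (Fin d)) P :=
  ⟨fun ω => gradientNoise g f η α τ x₀ (ξ ω) k i, memLp_gradientNoise hg hξ k i⟩

lemma integrable_noiseTerm_gradientNoise (hg : ∀ i, IsStochasticGradient (g i) (f i) σ (D i))
    (hξ : IsIndepSampling ξ D P) {V : Ω → EuclideanSpace ℝ (Fin d)} (hV : MemLp V 2 P) (a b : ℝ)
    (k : ℕ) :
    Integrable (fun ω => noiseTerm α τ a b (gradientNoise g f η α τ x₀ (ξ ω)) (V ω) k) P :=
  integrable_noiseTerm_evalAt (e := gradientNoiseL2 hg hξ η α τ x₀) (V := ⟨V, hV⟩) a b k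

lemma integral_noiseTerm_gradientNoise_le [Nonempty (Fin m)]
    (hg : ∀ i, IsStochasticGradient (g i) (f i) σ (D i)) (hξ : IsIndepSampling ξ D P)
    (hα₀ : 0 < α) (hα₂ : α < 2) (hτ : 0 < τ) {a b : ℝ} (ha : 0 ≤ a) (hb : 0 ≤ b) {k : ℕ}
    {V : Ω → EuclideanSpace ℝ (Fin d)} (hV2 : MemLp V 2 P)
    (hV : ∀ i, Measurable[otherSamples (fun (p : ℕ × Fin m) ω => ξ ω p.1 p.2) (k, i)] V) :
    ∫ ω, noiseTerm α τ a b (gradientNoise g f η α τ x₀ (ξ ω)) (V ω) k ∂P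
      ≤ a * (σ ^ 2 * (τ / (α * (2 - α)) - 1)) + b * (σ ^ 2 / m) := by
  refine (integral_noiseTerm_evalAt (e := gradientNoiseL2 hg hξ η α τ x₀) (V := ⟨V, hV2⟩) a b
    k).trans_le ?_
  refine (noiseTerm_le_of_orthogonal (fun p q hpq => ?_) (fun j i => ?_) hα₀ hα₂ hτ ha hb
    fun i => ?_).trans_eq (by rw [Fintype.card_fin])
  · exact (integral_inner_evalAt _ _).symm.trans (integral_inner_gradientNoise_of_ne hg hξ hpq)
  · exact (integral_norm_evalAt_sq _).symm.trans_le (integral_norm_gradientNoise_sq_le hg hξ j i)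
  · exact (integral_inner_evalAt _ _).symm.trans
      (integral_inner_gradientNoise_eq_zero hg hξ (hV i) hV2)

end Run

/-! ### The bound in expectation -/

lemma memLp_comp_of_lipschitzWith {Ω E : Type*} [MeasurableSpace Ω] {P : Measure Ω}
    [IsFiniteMeasure P] [NormedAddCommGroup E] {f : E → E} {L : NNReal} (hf : LipschitzWith L f)
    {X : Ω → E} {p : ENNReal} (hX : MemLp X p P) : MemLp (fun ω => f (X ω)) p P := by
  have hsub : LipschitzWith L fun x => f x - f 0 := by
    simpa using hf.sub (LipschitzWith.const (f 0))
  exact (memLp_congr_ae (ae_of_all _ fun ω => sub_add_cancel _ _)).1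
    ((hsub.comp_memLp (sub_self _) hX).add (memLp_const (f 0)))

lemma sum_norm_gradient_virtualModel_sq_le {d m : ℕ} [Nonempty (Fin m)] {S : Type*}
    {g : Fin m → EuclideanSpace ℝ (Fin d) → S → EuclideanSpace ℝ (Fin d)}
    {f : Fin m → EuclideanSpace ℝ (Fin d) → EuclideanSpace ℝ (Fin d)}
    {F : EuclideanSpace ℝ (Fin d) → ℝ} {η α κ F_inf : ℝ} {L : NNReal} {τ : ℕ}
    {x₀ : EuclideanSpace ℝ (Fin d)} {ξ : ℕ → Fin m → S}
    (hF : ∀ x, HasGradientAt F (mean fun i => f i x) x) (hF_inf : ∀ x, F_inf ≤ F x)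
    (hf : ∀ i, LipschitzWith L (f i)) (hκ : ∀ x, meanSq (deviation fun i => f i x) ≤ κ ^ 2)
    (hα₀ : 0 < α) (hα₁ : α < 1) (hτ : 0 < τ) (hη₀ : 0 < η)
    (hη : 60 * (η * L * (τ / α)) ^ 2 ≤ 1) (K : ℕ) :
    ∑ k ∈ Finset.range K, ‖mean fun i => f i (virtualModel α (iterate g η α τ x₀ ξ k))‖ ^ 2
      ≤ 2 / ((1 - α) * η) * (F (virtualModel α (initialState m x₀)) - F_inf)
        + 2 * (η * L * (τ / α)) ^ 2 * (K * κ ^ 2)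
        + ∑ k ∈ Finset.range K, noiseTerm α τ (4 * (η * L) ^ 2) ((1 - α) * η * L)
          (gradientNoise g f η α τ x₀ ξ)
          ((2 * ((1 - α) * η) * L) • mean (Pi.map f (iterate g η α τ x₀ ξ k).x)
            - (2 : ℝ) • mean fun i => f i (virtualModel α (iterate g η α τ x₀ ξ k))) k := by
  have : 0 < 1 - α := sub_pos.2 hα₁
  have hG : sampledGradient g η α τ x₀ ξ = fun k =>
      Pi.map f (iterate g η α τ x₀ ξ k).x + gradientNoise g f η α τ x₀ ξ k := by
    funext k i
    exact (add_sub_cancel _ _).symm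
  have hrun := isOverlapLocalSGD_iterate g η α τ x₀ ξ
  rw [hG] at hrun
  refine (sum_norm_gradient_sq_le hrun hF hf hκ hα₀ hα₁ hτ hη₀ hη K).trans ?_
  gcongr
  · exact le_rfl
  · exact hF_inf _

section Expectation

variable {Ω S : Type*} [MeasurableSpace S] {d m : ℕ}
  {g : Fin m → EuclideanSpace ℝ (Fin d) → S → EuclideanSpace ℝ (Fin d)}
  {f : Fin m → EuclideanSpace ℝ (Fin d) → EuclideanSpace ℝ (Fin d)}
  {η α σ κ : ℝ} {L : NNReal} {τ : ℕ} {x₀ : EuclideanSpace ℝ (Fin d)} {ξ : Ω → ℕ → Fin m → S}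
  {D : Fin m → Measure S}

lemma measurable_otherSamples_smul_mean_map_sub
    (hg : ∀ i, IsStochasticGradient (g i) (f i) σ (D i)) (hf : ∀ i, LipschitzWith L (f i))
    (a b : ℝ) (k : ℕ) (i : Fin m) :
    Measurable[otherSamples (fun (p : ℕ × Fin m) ω => ξ ω p.1 p.2) (k, i)] fun ω =>
      a • mean (Pi.map f (iterate g η α τ x₀ (ξ ω) k).x)
        - b • mean fun i => f i (virtualModel α (iterate g η α τ x₀ (ξ ω) k)) := by
  obtain ⟨hx, hz⟩ := iterate_mem_measurableFunctions (mΩ := otherSamples _ (k, i))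
    (fun l => (hg l).measurable) k (measurable_otherSamples_of_lt ξ k i)
  exact smul_mean_map_sub_mem (C := measurableFunctions (otherSamples _ (k, i)) _)
    (fun l _ hX => (hf l).continuous.measurable.comp hX) hx hz a b

variable [MeasurableSpace Ω] {P : Measure Ω} [IsProbabilityMeasure P]

lemma iterate_mem_squareIntegrable (hg : ∀ i, IsStochasticGradient (g i) (f i) σ (D i))
    (hξ : IsIndepSampling ξ D P) (hf : ∀ i, LipschitzWith L (f i)) (k : ℕ) :
    (∀ i, (fun ω => (iterate g η α τ x₀ (ξ ω) k).x i) ∈ squareIntegrable _ P) ∧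
      (fun ω => (iterate g η α τ x₀ (ξ ω) k).z) ∈ squareIntegrable _ P := by
  refine iterate_mem (memLp_const x₀) k fun j _ hx i => ?_
  have h := (memLp_comp_of_lipschitzWith (hf i) (hx i)).add
    (memLp_gradientNoise (η := η) (α := α) (τ := τ) (x₀ := x₀) hg hξ j i)
  exact (memLp_congr_ae (ae_of_all _ fun ω => add_sub_cancel _ _)).1 h

lemma integrable_norm_mean_virtualModel_sq (hg : ∀ i, IsStochasticGradient (g i) (f i) σ (D i))
    (hξ : IsIndepSampling ξ D P) (hf : ∀ i, LipschitzWith L (f i)) (k : ℕ) :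
    Integrable (fun ω => ‖mean fun i => f i (virtualModel α (iterate g η α τ x₀ (ξ ω) k))‖ ^ 2)
      P := by
  obtain ⟨hx, hz⟩ := iterate_mem_squareIntegrable hg hξ hf k
  have hmean := mean_comp_mem (C := squareIntegrable _ P)
    (X := fun ω i => f i (virtualModel α (iterate g η α τ x₀ (ξ ω) k)))
    fun i => memLp_comp_of_lipschitzWith (hf i) (virtualModel_mem hx hz)
  exact MemLp.integrable_norm_pow hmean two_ne_zero

variable {F : EuclideanSpace ℝ (Fin d) → ℝ} {F_inf : ℝ} [Nonempty (Fin m)]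

lemma sum_integral_norm_gradient_sq_le (hg : ∀ i, IsStochasticGradient (g i) (f i) σ (D i))
    (hξ : IsIndepSampling ξ D P) (hF : ∀ x, HasGradientAt F (mean fun i => f i x) x)
    (hF_inf : ∀ x, F_inf ≤ F x) (hf : ∀ i, LipschitzWith L (f i))
    (hκ : ∀ x, meanSq (deviation fun i => f i x) ≤ κ ^ 2) (hα₀ : 0 < α) (hα₁ : α < 1)
    (hτ : 0 < τ) (hη₀ : 0 < η) (hη : 60 * (η * L * (τ / α)) ^ 2 ≤ 1) (K : ℕ) :
    ∑ k ∈ Finset.range K,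
        ∫ ω, ‖mean fun i => f i (virtualModel α (iterate g η α τ x₀ (ξ ω) k))‖ ^ 2 ∂P
      ≤ 2 / ((1 - α) * η) * (F (virtualModel α (initialState m x₀)) - F_inf)
        + 2 * (η * L * (τ / α)) ^ 2 * (K * κ ^ 2)
        + K * (4 * (η * L) ^ 2 * (σ ^ 2 * (τ / (α * (2 - α)) - 1))
          + (1 - α) * η * L * (σ ^ 2 / m)) := by
  have : 0 < 1 - α := sub_pos.2 hα₁
  set c := 2 / ((1 - α) * η) * (F (virtualModel α (initialState m x₀)) - F_inf)
    + 2 * (η * L * (τ / α)) ^ 2 * (K * κ ^ 2)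
  let V : ℕ → Ω → EuclideanSpace ℝ (Fin d) := fun k ω =>
    (2 * ((1 - α) * η) * L) • mean (Pi.map f (iterate g η α τ x₀ (ξ ω) k).x)
      - (2 : ℝ) • mean fun i => f i (virtualModel α (iterate g η α τ x₀ (ξ ω) k))
  let N : ℕ → Ω → ℝ := fun k ω => noiseTerm α τ (4 * (η * L) ^ 2) ((1 - α) * η * L)
    (gradientNoise g f η α τ x₀ (ξ ω)) (V k ω) k
  have hV : ∀ k, MemLp (V k) 2 P := by
    intro k
    obtain ⟨hx, hz⟩ := iterate_mem_squareIntegrable hg hξ hf k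
    exact smul_mean_map_sub_mem (C := squareIntegrable _ P)
      (fun i _ hX => memLp_comp_of_lipschitzWith (hf i) hX) hx hz _ _
  have hN : ∀ k, Integrable (N k) P := fun k =>
    integrable_noiseTerm_gradientNoise hg hξ (hV k) _ _ k
  have hpath : ∀ ω, ∑ k ∈ Finset.range K,
      ‖mean fun i => f i (virtualModel α (iterate g η α τ x₀ (ξ ω) k))‖ ^ 2
        ≤ c + ∑ k ∈ Finset.range K, N k ω := fun ω =>
    sum_norm_gradient_virtualModel_sq_le hF hF_inf hf hκ hα₀ hα₁ hτ hη₀ hη K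
  rw [← integral_finsetSum _ fun k _ => integrable_norm_mean_virtualModel_sq hg hξ hf k]
  calc _ ≤ ∫ ω, c + ∑ k ∈ Finset.range K, N k ω ∂P :=
        integral_mono (integrable_finsetSum _ fun k _ =>
          integrable_norm_mean_virtualModel_sq hg hξ hf k)
          ((integrable_const c).add (integrable_finsetSum _ fun k _ => hN k)) hpath
    _ = c + ∑ k ∈ Finset.range K, ∫ ω, N k ω ∂P := by
        rw [integral_add (integrable_const c) (integrable_finsetSum _ fun k _ => hN k),
          integral_finsetSum _ fun k _ => hN k, integral_const, probReal_univ, one_smul]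
    _ ≤ _ := by
        gcongr
        refine (Finset.sum_le_card_nsmul _ _ _ fun k _ =>
          integral_noiseTerm_gradientNoise_le hg hξ hα₀ (by linarith) hτ (by positivity)
            (by positivity) (hV k)
            (measurable_otherSamples_smul_mean_map_sub hg hf _ _ k)).trans_eq ?_
        rw [Finset.card_range, nsmul_eq_mul]

end Expectation

/-! ### The learning rate -/

section LearningRate

variable {L : ℝ} {m K : ℕ}

lemma learningRate_pos (hL : 0 < L) (hm : 0 < m) (hK : 0 < K) : 0 < learningRate L m K := by
  rw [learningRate]
  positivity

lemma learningRate_mul_eq_sqrt (hL : L ≠ 0) (m K : ℕ) : learningRate L m K * L = √(m / K) := by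
  rw [learningRate]
  field_simp

lemma learningRate_mul_sq (hL : L ≠ 0) (m K : ℕ) : (learningRate L m K * L) ^ 2 = m / K := by
  rw [learningRate_mul_eq_sqrt hL, Real.sq_sqrt (by positivity)]

lemma learningRate_mul_mul (hL : L ≠ 0) (m K : ℕ) : learningRate L m K * L * K = √(m * K) := by
  rw [learningRate_mul_eq_sqrt hL, Real.sqrt_div m.cast_nonneg, Real.sqrt_mul m.cast_nonneg,
    div_mul_eq_mul_div, mul_div_assoc, Real.div_sqrt]

lemma mul_learningRate_mul_div_sq_le {α c : ℝ} {τ : ℕ} (hL : L ≠ 0) (hα : α ≠ 0) (hK : 0 < K)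
    (h : c * m * τ ^ 2 / α ^ 2 ≤ K) : c * (learningRate L m K * L * (τ / α)) ^ 2 ≤ 1 := by
  have hK' : (0 : ℝ) < K := Nat.cast_pos.2 hK
  have heq : c * (learningRate L m K * L * (τ / α)) ^ 2 = c * m * τ ^ 2 / α ^ 2 / K := by
    rw [mul_pow, learningRate_mul_sq hL]
    field_simp
  rw [heq]
  exact (div_le_one hK').2 h

lemma average_le_errorBound {Δ σ κ α : ℝ} {τ : ℕ} (hL : 0 < L) (hΔ : 0 ≤ Δ) (hα₀ : 0 < α)
    (hα₁ : α < 1) (hm : 0 < m) (hK : 0 < K) :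
    1 / (K : ℝ) * (2 / ((1 - α) * learningRate L m K) * Δ
      + 2 * (learningRate L m K * L * (τ / α)) ^ 2 * (K * κ ^ 2)
      + K * (4 * (learningRate L m K * L) ^ 2 * (σ ^ 2 * (τ / (α * (2 - α)) - 1))
        + (1 - α) * learningRate L m K * L * (σ ^ 2 / m)))
      ≤ errorBound L Δ σ κ α τ m K := by
  have : (0 : ℝ) < K := Nat.cast_pos.2 hK
  have h1α : 0 < 1 - α := sub_pos.2 hα₁
  have h2α : 0 < 2 - α := by linarith
  have hsq := learningRate_mul_sq hL.ne' m K
  have hmul := learningRate_mul_mul hL.ne' m K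
  have hs : 0 < √((m : ℝ) * K) := by positivity
  have hss : √((m : ℝ) * K) ^ 2 = m * K := Real.sq_sqrt (by positivity)
  set s := √((m : ℝ) * K)
  have hη : learningRate L m K = s / (L * K) := by rw [← hmul]; field_simp
  have hdescent : 2 / ((1 - α) * learningRate L m K) * Δ / K = 2 * L * Δ / ((1 - α) * s) := by
    rw [hη]; field_simp
  have hdissimilarity : 2 * (learningRate L m K * L * (τ / α)) ^ 2 * κ ^ 2
      = 2 * m * τ ^ 2 * κ ^ 2 / (α ^ 2 * K) := by
    rw [mul_pow, hsq]; field_simp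
  have hdrift : 4 * (learningRate L m K * L) ^ 2 * (σ ^ 2 * (τ / (α * (2 - α)) - 1))
      = 2 * m * σ ^ 2 / K * (2 / ((2 - α) * α) * τ - 2) := by
    rw [hsq]; field_simp; ring
  have hvariance : (1 - α) * learningRate L m K * L * (σ ^ 2 / m) = (1 - α) * σ ^ 2 / s := by
    rw [hη]; field_simp; rw [hss]; ring
  calc _ = 2 * L * Δ / ((1 - α) * s) + (1 - α) * σ ^ 2 / s
          + 2 * m * σ ^ 2 / K * (2 / ((2 - α) * α) * τ - 2)
          + 2 * m * τ ^ 2 * κ ^ 2 / (α ^ 2 * K) := by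
        rw [← hdescent, ← hdissimilarity, ← hdrift, ← hvariance]; field_simp; ring
    _ ≤ errorBound L Δ σ κ α τ m K := by
        unfold errorBound
        gcongr <;> linarith

end LearningRate

lemma exists_abs_errorBound_le (L Δ σ κ α : ℝ) (τ : ℕ) :
    ∃ C₁ C₂ : ℝ, ∀ m K : ℕ, 0 < m → 0 < K →
      |errorBound L Δ σ κ α τ m K| ≤ C₁ / √((m : ℝ) * (K : ℝ)) + C₂ * (m : ℝ) / (K : ℝ) := by
  refine ⟨|4 * L * Δ / (1 - α) + 2 * (1 - α) * σ ^ 2|,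
    |2 * σ ^ 2 * (2 / ((2 - α) * α) * τ - 1) + 2 * τ ^ 2 * κ ^ 2 / α ^ 2|, fun m K _ _ => ?_⟩
  have h : errorBound L Δ σ κ α τ m K
      = (4 * L * Δ / (1 - α) + 2 * (1 - α) * σ ^ 2) / √(m * K)
        + (2 * σ ^ 2 * (2 / ((2 - α) * α) * τ - 1) + 2 * τ ^ 2 * κ ^ 2 / α ^ 2) * m / K := by
    rw [errorBound, ← div_div, ← div_div]
    ring
  rw [h]
  refine (abs_add_le _ _).trans_eq ?_
  rw [abs_div, abs_of_nonneg (Real.sqrt_nonneg _), abs_div, abs_mul, Nat.abs_cast, Nat.abs_cast]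

lemma hasGradientAt_objective {d m : ℕ} {S : Type*} [MeasurableSpace S]
    {ℓ : EuclideanSpace ℝ (Fin d) → S → ℝ} {D : Fin m → Measure S}
    (hdiff : ∀ i, Differentiable ℝ (localObjective ℓ D i)) (x : EuclideanSpace ℝ (Fin d)) :
    HasGradientAt (objective ℓ D) (mean fun i => gradient (localObjective ℓ D i) x) x := by
  rw [hasGradientAt_iff_hasFDerivAt, ← one_div_smul_sum_eq_mean, map_smul, map_sum]
  exact (HasFDerivAt.fun_sum (u := Finset.univ)
    fun i _ => (hdiff i x).hasGradientAt.hasFDerivAt).const_mul (1 / (m : ℝ))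

end

end OverlapLocalSGD

open OverlapLocalSGD in
theorem theorem1 {d m : ℕ} {S Ω : Type*} [MeasurableSpace S] [MeasurableSpace Ω]
    (hm : 0 < m)
    -- data distributions, loss, stochastic gradients
    (D : Fin m → Measure S) [∀ i, IsProbabilityMeasure (D i)]
    (ℓ : EuclideanSpace ℝ (Fin d) → S → ℝ)
    (hℓ : ∀ i x, Integrable (ℓ x) (D i))
    (g : Fin m → EuclideanSpace ℝ (Fin d) → S → EuclideanSpace ℝ (Fin d))
    (hg : ∀ i, Measurable (Function.uncurry (g i)))
    (L σ κ F_inf : ℝ) (hL : 0 < L)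
    -- `F_inf` is a lower bound of the objective
    (hF_inf : ∀ x, F_inf ≤ OverlapLocalSGD.objective ℓ D x)
    -- every local objective is `L`-smooth
    (hdiff : ∀ i, Differentiable ℝ (OverlapLocalSGD.localObjective ℓ D i))
    (hsmooth : ∀ i x y,
      ‖gradient (OverlapLocalSGD.localObjective ℓ D i) x
        - gradient (OverlapLocalSGD.localObjective ℓ D i) y‖ ≤ L * ‖x - y‖)
    -- unbiased stochastic gradients
    (hunbiased : ∀ i x, Integrable (g i x) (D i) ∧
      ∫ s, g i x s ∂(D i) = gradient (OverlapLocalSGD.localObjective ℓ D i) x)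
    -- bounded variance
    (hvar : ∀ i x,
      Integrable (fun s => ‖g i x s - gradient (OverlapLocalSGD.localObjective ℓ D i) x‖ ^ 2)
        (D i) ∧
      ∫ s, ‖g i x s - gradient (OverlapLocalSGD.localObjective ℓ D i) x‖ ^ 2 ∂(D i) ≤ σ ^ 2)
    -- bounded gradient dissimilarity
    (hdissim : ∀ x, (1 / (m : ℝ)) * ∑ i,
      ‖gradient (OverlapLocalSGD.localObjective ℓ D i) x
        - gradient (OverlapLocalSGD.objective ℓ D) x‖ ^ 2 ≤ κ ^ 2)
    -- the samples `ξ k i ∼ D i`, independent over iterations and workers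
    (P : Measure Ω) [IsProbabilityMeasure P]
    (ξ : ℕ → Fin m → Ω → S)
    (hξ : ∀ k i, Measurable (ξ k i))
    (hlaw : ∀ k i, P.map (ξ k i) = D i)
    (hindep : iIndepFun (fun p : ℕ × Fin m => ξ p.1 p.2) P)
    -- parameters of the run
    (x₀ : EuclideanSpace ℝ (Fin d))
    (α : ℝ) (hα₀ : 0 < α) (hα₁ : α < 1)
    (τ : ℕ) (hτ : 0 < τ)
    (K : ℕ) (hK : 60 * (m : ℝ) * (τ : ℝ) ^ 2 / α ^ 2 ≤ (K : ℝ)) :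
    let η : ℝ := OverlapLocalSGD.learningRate L m K
    let X : ℕ → Ω → OverlapLocalSGD.State d m := fun k ω =>
      OverlapLocalSGD.iterate g η α τ x₀ (fun j i => ξ j i ω) k
    let y : ℕ → Ω → EuclideanSpace ℝ (Fin d) := fun k ω =>
      OverlapLocalSGD.virtualModel α (X k ω)
    let Δ : ℝ := OverlapLocalSGD.objective ℓ D
      (OverlapLocalSGD.virtualModel α (OverlapLocalSGD.initialState m x₀)) - F_inf
    -- `y` follows an SGD recursion with effective step `(1 - α) η`
    (∀ k ω, y (k + 1) ω =
      y k ω - ((1 - α) * η) • ((1 / (m : ℝ)) • ∑ i, g i ((X k ω).x i) (ξ k i ω))) ∧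
    -- the expectations are finite, and their average obeys the explicit bound
    (∀ k, Integrable (fun ω => ‖gradient (OverlapLocalSGD.objective ℓ D) (y k ω)‖ ^ 2) P) ∧
    (1 / (K : ℝ)) * ∑ k ∈ Finset.range K,
        ∫ ω, ‖gradient (OverlapLocalSGD.objective ℓ D) (y k ω)‖ ^ 2 ∂P
      ≤ OverlapLocalSGD.errorBound L Δ σ κ α τ m K ∧
    -- the bound is `O(1/√(mK)) + O(m/K)`, with constants independent of `m` and `K`
    (∃ C₁ C₂ : ℝ, ∀ m' K' : ℕ, 0 < m' → 0 < K' →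
      |OverlapLocalSGD.errorBound L Δ σ κ α τ m' K'|
        ≤ C₁ / Real.sqrt ((m' : ℝ) * (K' : ℝ)) + C₂ * (m' : ℝ) / (K' : ℝ)) := by
  intro η X y Δ
  have : Nonempty (Fin m) := Fin.pos_iff_nonempty.1 hm
  have hK₀ : 0 < K := Nat.cast_pos.1 (lt_of_lt_of_le (by positivity) hK)
  lift L to NNReal using hL.le
  have hlip i : LipschitzWith L (gradient (localObjective ℓ D i)) :=
    LipschitzWith.of_dist_le_mul fun x y => by simpa only [dist_eq_norm] using hsmooth i x y
  have hstoch i : IsStochasticGradient (g i) (gradient (localObjective ℓ D i)) σ (D i) :=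
    ⟨hg i, fun x => (hunbiased i x).1, fun x => (hunbiased i x).2, fun x => (hvar i x).1,
      fun x => (hvar i x).2⟩
  have hsample : IsIndepSampling (fun ω k i => ξ k i ω) D P := ⟨hξ, hlaw, hindep⟩
  have hgrad := hasGradientAt_objective hdiff
  simp only [one_div_smul_sum_eq_mean, fun x => (hgrad x).gradient] at hdissim ⊢
  refine ⟨fun k ω => virtualModel_succ g η α τ x₀ _ k,
    integrable_norm_mean_virtualModel_sq hstoch hsample hlip, ?_,
    exists_abs_errorBound_le L Δ σ κ α τ⟩
  have hsum := sum_integral_norm_gradient_sq_le (x₀ := x₀) hstoch hsample hgrad hF_inf hlip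
    (fun x => (one_div_smul_sum_eq_mean _).symm.trans_le (hdissim x)) hα₀ hα₁ hτ
    (learningRate_pos hL hm hK₀) (mul_learningRate_mul_div_sq_le hL.ne' hα₀.ne' hK₀ hK) K
  exact (mul_le_mul_of_nonneg_left hsum (by positivity)).trans
    (average_le_errorBound hL (sub_nonneg.2 (hF_inf _)) hα₀ hα₁ hm hK₀)
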